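/- Let $\Omega\subset\mathbb{R}^4$ be a bounded domain (open and connected) with $0\in\Omega$ and $\Omega=-\Omega$, and for $\varepsilon>0$ let $\Omega_\varepsilon:=\Omega\setminus\overline{B_\varepsilon(0)}$. Let $\alpha_4:=2\sqrt2$ and, for $\delta>0$, let $U_\delta(x):=\alpha_4\,\dfrac{\delta}{\delta^2+|x|^2}$, $x\in\mathbb{R}^4$; denote by $P_\varepsilon U_\delta\in H^1_0(\Omega_\varepsilon)$ the unique weak solution $W$ of \[ -\Delta W=-\Delta U_\delta=U_\delta^3\ \text{ in }\Omega_\varepsilon,\qquad W=0\ \text{ on }\partial\Omega_\varepsilon . \] Let $k\in\mathbb{N}$ and $\eta>0$, let $X_\eta:=\{\mathbf d\in\mathbb{R}^k:\ \eta<d_1,\dots,d_k<1/\eta\}$, and for $\mathbf d\in X_\eta$ and $\varepsilon\in(0,1)$ put \[ \delta_j:=d_j\,\varepsilon^{\frac{j}{k+1}}\Big(\log\frac1\varepsilon\Big)^{\frac12-\frac{j}{k+1}},\qquad U_j:=U_{\delta_j},\qquad j=1,\dots,k . \] Then for all $i,j\in\{1,\dots,k\}$ with $i>j$, \[ \int_{\Omega_\varepsilon}(P_\varepsilon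 U_i)^2(P_\varepsilon U_j)^2=\alpha_4^4\,|\mathbb{S}^3|\Big(\frac{\delta_i}{\delta_j}\Big)^2\log\frac{\delta_j}{\delta_i}+o\Big(\Big(\frac{\delta_i}{\delta_j}\Big)^2\log\frac{\delta_j}{\delta_i}\Big)\qquad\text{as }\varepsilon\to0^+, \] uniformly for $\mathbf d\in X_\eta$, where $|\mathbb{S}^3|$ is the surface measure of the unit sphere of $\mathbb{R}^4$. -/

import Mathlib

open MeasureTheory Set Filter Topology
open scoped Gradient ContDiff NNReal

/-- Euclidean space `ℝ⁴`. -/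
abbrev R4 : Type := EuclideanSpace ℝ (Fin 4)

/-- `φ ∈ C_c^∞(D)`. -/
def IsTestFunction (D : Set R4) (φ : R4 → ℝ) : Prop :=
  ContDiff ℝ ∞ φ ∧ HasCompactSupport φ ∧ tsupport φ ⊆ D

/-- `W ∈ H¹₀(D)`, with weak gradient `G`: the pair `(W, G)` is the limit, in `L²(D) × L²(D; ℝ⁴)`,
of pairs `(φₙ, ∇φₙ)` with `φₙ ∈ C_c^∞(D)`. -/
def IsH10 (D : Set R4) (W : R4 → ℝ) (G : R4 → R4) : Prop :=
  MemLp W 2 (volume.restrict D) ∧ MemLp G 2 (volume.restrict D) ∧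
    ∃ φ : ℕ → R4 → ℝ, (∀ n, IsTestFunction D (φ n)) ∧
      Tendsto (fun n => eLpNorm (φ n - W) 2 (volume.restrict D)) atTop (𝓝 0) ∧
      Tendsto (fun n => eLpNorm (∇ (φ n) - G) 2 (volume.restrict D)) atTop (𝓝 0)

/-- `W ∈ H¹₀(D)` is a weak solution of `-ΔW = f` in `D`, `W = 0` on `∂D`. -/
def IsDirichletSolution (D : Set R4) (f : R4 → ℝ) (W : R4 → ℝ) : Prop :=
  ∃ G : R4 → R4, IsH10 D W G ∧
    ∀ φ : R4 → ℝ, IsTestFunction D φ → ∫ x in D, inner ℝ (G x) (∇ φ x) = ∫ x in D, f x * φ x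

open Classical in
/-- The weak solution in `H¹₀(D)` of `-ΔW = f` in `D`, `W = 0` on `∂D` (a representative of its
class modulo null sets). For bounded `D` and `f ∈ L²(D)` it exists and is unique almost everywhere
in `D`, see `isDirichletSolution_dirichletSolution` and `IsDirichletSolution.ae_eq`. -/
noncomputable def dirichletSolution (D : Set R4) (f : R4 → ℝ) : R4 → ℝ :=
  if h : ∃ W, IsDirichletSolution D f W then h.choose else 0

/-- The constant `α₄ = 2√2`. -/
noncomputable def alpha4 : ℝ := 2 * √2

/-- The bubble `U_δ(x) = α₄ δ / (δ² + |x|²)` centred at the origin. -/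
noncomputable def bubble (δ : ℝ) (x : R4) : ℝ := alpha4 * (δ / (δ ^ 2 + ‖x‖ ^ 2))

/-- The domain with one hole `Ω_ε = Ω \ closure B_ε(0)`. -/
def holedDomain (Ω : Set R4) (ε : ℝ) : Set R4 := Ω \ Metric.closedBall 0 ε

/-- The projection `P_ε U_δ ∈ H¹₀(Ω_ε)` of the bubble: the solution of `-ΔW = -ΔU_δ = U_δ³` in
`Ω_ε`, `W = 0` on `∂Ω_ε`. -/
noncomputable def projBubble (Ω : Set R4) (ε δ : ℝ) : R4 → ℝ :=
  dirichletSolution (holedDomain Ω ε) (fun x => bubble δ x ^ 3)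

/-- The concentration rates `δ_j = d_j ε^{j/(k+1)} (log (1/ε))^{1/2 - j/(k+1)}`, `j = 1, …, k`.
The index `j : Fin k` runs over `0, …, k-1`, so that `j + 1` is the index in `{1, …, k}`. -/
noncomputable def rate {k : ℕ} (ε : ℝ) (d : Fin k → ℝ) (j : Fin k) : ℝ :=
  d j * ε ^ ((((j : ℕ) : ℝ) + 1) / (k + 1)) *
    Real.log (1 / ε) ^ ((1 : ℝ) / 2 - (((j : ℕ) : ℝ) + 1) / (k + 1))

/-- The parameter set `X_η = {d ∈ ℝᵏ : η < d₁, …, d_k < 1/η}`. -/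
def paramSet (k : ℕ) (η : ℝ) : Set (Fin k → ℝ) := {d | ∀ j, η < d j ∧ d j < 1 / η}

/-- The surface measure `|𝕊³|` of the unit sphere of `ℝ⁴`. -/
noncomputable def areaS3 : ℝ := (volume : Measure R4).toSphere.real univ

namespace IsTestFunction
variable {D : Set R4} {φ ψ : R4 → ℝ}

lemma gradient_eq (φ : R4 → ℝ) : ∇ φ = fun x => (InnerProductSpace.toDual ℝ R4).symm (fderiv ℝ φ x) := rfl

lemma continuous_gradient (h : IsTestFunction D φ) : Continuous (∇ φ) := by
  rw [gradient_eq]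
  exact (LinearIsometryEquiv.continuous _).comp (h.1.continuous_fderiv (by simp))

lemma memLp (h : IsTestFunction D φ) : MemLp φ 2 (volume.restrict D) :=
  (h.1.continuous.memLp_of_hasCompactSupport h.2.1).restrict D

lemma memLp_gradient (h : IsTestFunction D φ) : MemLp (∇ φ) 2 (volume.restrict D) :=
  (h.continuous_gradient.memLp_of_hasCompactSupport (by
    rw [gradient_eq]
    exact (h.2.1.fderiv ℝ).comp_left (g := (InnerProductSpace.toDual ℝ R4).symm) (map_zero _))).restrict D

lemma zero : IsTestFunction D 0 :=
  ⟨contDiff_const, HasCompactSupport.zero, by simp [tsupport]⟩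

lemma add (h : IsTestFunction D φ) (h' : IsTestFunction D ψ) : IsTestFunction D (φ + ψ) :=
  ⟨h.1.add h'.1, h.2.1.add h'.2.1, (tsupport_add φ ψ).trans (union_subset h.2.2 h'.2.2)⟩

lemma smul (h : IsTestFunction D φ) (c : ℝ) : IsTestFunction D (c • φ) :=
  ⟨h.1.const_smul c, h.2.1.smul_left (f := fun _ => c), (closure_mono (Function.support_const_smul_subset c φ)).trans h.2.2⟩

lemma gradient_add (h : IsTestFunction D φ) (h' : IsTestFunction D ψ) :
    ∇ (φ + ψ) = ∇ φ + ∇ ψ := by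
  ext1 x
  simp only [gradient_eq, Pi.add_apply]
  rw [fderiv_add (h.1.differentiable (by simp) x) (h'.1.differentiable (by simp) x), map_add]

lemma gradient_smul (h : IsTestFunction D φ) (c : ℝ) : ∇ (c • φ) = c • ∇ φ := by
  ext1 x
  simp only [gradient_eq, Pi.smul_apply]
  rw [fderiv_const_smul (h.1.differentiable (by simp) x), map_smul]

/-- Poincaré's inequality. -/
lemma exists_poincare (hD : Bornology.IsBounded D) : ∃ C : ℝ≥0, ∀ φ, IsTestFunction D φ →
    eLpNorm φ 2 (volume.restrict D) ≤ C * eLpNorm (∇ φ) 2 (volume.restrict D) := by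
  refine ⟨eLpNormLESNormFDerivOfLeConst ℝ (volume : Measure R4) D 2 2, fun φ h => ?_⟩
  have key := eLpNorm_le_eLpNorm_fderiv_of_le (μ := (volume : Measure R4)) (s := D) (p := 2) (q := 2)
    (h.1.of_le (by simp)) ((subset_tsupport φ).trans h.2.2) (by norm_num)
    (by simp; norm_num) (by simp) hD
  have e : eLpNorm (∇ φ) 2 (volume.restrict D) = eLpNorm (fderiv ℝ φ) 2 volume := by
    rw [eLpNorm_restrict_eq_of_support_subset]
    · exact eLpNorm_congr_norm_ae (ae_of_all _ fun x => by simp [gradient_eq])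
    · intro x hx
      refine h.2.2 (support_fderiv_subset ℝ (f := φ) ?_)
      intro h0
      exact hx (by simp [gradient_eq, h0])
  rw [e]
  exact (eLpNorm_mono_measure _ Measure.restrict_le_self).trans key

end IsTestFunction

section Existence
variable {D : Set R4}

/-- The Hilbert space `L²(D) × L²(D; ℝ⁴)`. -/
abbrev PairL2 (D : Set R4) : Type :=
  WithLp 2 (Lp ℝ 2 (volume.restrict D) × Lp R4 2 (volume.restrict D))

/-- The pair `(φ, ∇φ)` as an element of `L²(D) × L²(D; ℝ⁴)`. -/
noncomputable def IsTestFunction.pair {φ : R4 → ℝ} (h : IsTestFunction D φ) : PairL2 D :=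
  WithLp.toLp 2 (h.memLp.toLp φ, h.memLp_gradient.toLp (∇ φ))

lemma IsTestFunction.pair_add {φ ψ : R4 → ℝ} (h : IsTestFunction D φ) (h' : IsTestFunction D ψ) :
    (h.add h').pair = h.pair + h'.pair := by
  simp only [IsTestFunction.pair, ← WithLp.toLp_add, Prod.mk_add_mk, ← MemLp.toLp_add]
  congr 2
  exact (MemLp.toLp_eq_toLp_iff _ _).2 (by rw [h.gradient_add h'])

lemma IsTestFunction.pair_smul {φ : R4 → ℝ} (h : IsTestFunction D φ) (c : ℝ) :
    (h.smul c).pair = c • h.pair := by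
  simp only [IsTestFunction.pair, ← WithLp.toLp_smul, Prod.smul_mk, ← MemLp.toLp_const_smul]
  congr 2
  exact (MemLp.toLp_eq_toLp_iff _ _).2 (by rw [h.gradient_smul c])

/-- `H¹₀(D)` as a closed subspace of `L²(D) × L²(D; ℝ⁴)`. -/
noncomputable def H10Space (D : Set R4) : Submodule ℝ (PairL2 D) :=
  Submodule.topologicalClosure
    { carrier := {p | ∃ (φ : R4 → ℝ) (h : IsTestFunction D φ), p = h.pair}
      add_mem' := by
        rintro _ _ ⟨φ, h, rfl⟩ ⟨ψ, h', rfl⟩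
        exact ⟨φ + ψ, h.add h', (h.pair_add h').symm⟩
      zero_mem' := ⟨_, IsTestFunction.zero.smul 0,
        ((IsTestFunction.zero.pair_smul 0).trans (zero_smul _ _)).symm⟩
      smul_mem' := by
        rintro c _ ⟨φ, h, rfl⟩
        exact ⟨c • φ, h.smul c, (h.pair_smul c).symm⟩ }

lemma IsTestFunction.pair_mem {φ : R4 → ℝ} (h : IsTestFunction D φ) : h.pair ∈ H10Space D :=
  Submodule.le_topologicalClosure _ ⟨φ, h, rfl⟩

lemma H10Space.exists_poincare (hD : Bornology.IsBounded D) :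
    ∃ C : ℝ, 0 ≤ C ∧ ∀ p ∈ H10Space D, ‖p.fst‖ ≤ C * ‖p.snd‖ := by
  obtain ⟨C, hC⟩ := IsTestFunction.exists_poincare hD
  refine ⟨C, C.2, fun p hp => ?_⟩
  refine closure_minimal (t := {p : PairL2 D | ‖p.fst‖ ≤ C * ‖p.snd‖}) ?_ ?_ hp
  · rintro _ ⟨φ, h, rfl⟩
    have := ENNReal.toReal_mono
      (ENNReal.mul_ne_top ENNReal.coe_ne_top h.memLp_gradient.eLpNorm_ne_top) (hC φ h)
    simpa [IsTestFunction.pair, Lp.norm_toLp] using this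
  · exact isClosed_le (by fun_prop) (by fun_prop)

lemma IsH10.pair_mem {W : R4 → ℝ} {G : R4 → R4} (h : IsH10 D W G) :
    WithLp.toLp 2 (h.1.toLp W, h.2.1.toLp G) ∈ H10Space D := by
  obtain ⟨hW, hG, φ, hφ, h1, h2⟩ := h
  refine mem_closure_of_tendsto (f := fun n => (hφ n).pair) (b := atTop) ?_
    (Eventually.of_forall fun n => ⟨φ n, hφ n, rfl⟩)
  have t1 := (Lp.tendsto_Lp_iff_tendsto_eLpNorm'' φ (fun n => (hφ n).memLp) W hW).2 h1
  have t2 := (Lp.tendsto_Lp_iff_tendsto_eLpNorm'' (fun n => ∇ (φ n))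
    (fun n => (hφ n).memLp_gradient) G hG).2 h2
  exact ((WithLp.prod_continuous_toLp 2 _ _).tendsto _).comp (t1.prodMk_nhds t2)

lemma H10Space.isH10 {p : PairL2 D} (hp : p ∈ H10Space D) : IsH10 D p.fst p.snd := by
  refine ⟨Lp.memLp _, Lp.memLp _, ?_⟩
  obtain ⟨q, hq, ht⟩ := mem_closure_iff_seq_limit.1 hp
  choose φ hφ hqφ using hq
  refine ⟨φ, hφ, ?_, ?_⟩
  · have t : Tendsto (fun n => (q n).fst) atTop (𝓝 p.fst) :=
      ((WithLp.prod_continuous_ofLp 2 _ _).fst.tendsto p).comp ht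
    simp only [hqφ] at t
    refine (Lp.tendsto_Lp_iff_tendsto_eLpNorm'' φ (fun n => (hφ n).memLp) p.fst (Lp.memLp _)).1 ?_
    simpa [IsTestFunction.pair] using t
  · have t : Tendsto (fun n => (q n).snd) atTop (𝓝 p.snd) :=
      ((WithLp.prod_continuous_ofLp 2 _ _).snd.tendsto p).comp ht
    simp only [hqφ] at t
    refine (Lp.tendsto_Lp_iff_tendsto_eLpNorm'' (fun n => ∇ (φ n))
      (fun n => (hφ n).memLp_gradient) p.snd (Lp.memLp _)).1 ?_
    simpa [IsTestFunction.pair] using t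

lemma exists_isDirichletSolution {f : R4 → ℝ} (hD : Bornology.IsBounded D)
    (hf : MemLp f 2 (volume.restrict D)) : ∃ W, IsDirichletSolution D f W := by
  obtain ⟨C, hC0, hC⟩ := H10Space.exists_poincare hD
  have : CompleteSpace (H10Space D) := (Submodule.isClosed_topologicalClosure _).completeSpace_coe
  let T : H10Space D →L[ℝ] Lp R4 2 (volume.restrict D) :=
    (WithLp.sndL 2 ℝ _ _).comp (H10Space D).subtypeL
  let S : H10Space D →L[ℝ] Lp ℝ 2 (volume.restrict D) :=
    (WithLp.fstL 2 ℝ _ _).comp (H10Space D).subtypeL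
  let B : H10Space D →L[ℝ] H10Space D →L[ℝ] ℝ := (innerSL ℝ).bilinearComp T T
  have hB : IsCoercive B := by
    refine ⟨1 / (C ^ 2 + 1), by positivity, fun u => ?_⟩
    have e : B u u = ‖T u‖ ^ 2 := by simp [B]
    have h1 : ‖u‖ ^ 2 = ‖(u : PairL2 D).fst‖ ^ 2 + ‖T u‖ ^ 2 :=
      WithLp.prod_norm_sq_eq_of_L2 (u : PairL2 D)
    have h2 : ‖(u : PairL2 D).fst‖ ^ 2 ≤ (C * ‖T u‖) ^ 2 :=
      pow_le_pow_left₀ (norm_nonneg _) (hC u u.2) 2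
    rw [e, mul_assoc, ← sq, h1, div_mul_eq_mul_div, one_mul, div_le_iff₀ (by positivity)]
    nlinarith
  let F : H10Space D →L[ℝ] ℝ := (innerSL ℝ (hf.toLp f)).comp S
  let v : H10Space D := hB.continuousLinearEquivOfBilin.symm ((InnerProductSpace.toDual ℝ _).symm F)
  refine ⟨(v : PairL2 D).fst, (v : PairL2 D).snd, H10Space.isH10 v.2, fun φ hφ => ?_⟩
  have key : B v ⟨hφ.pair, hφ.pair_mem⟩ = F ⟨hφ.pair, hφ.pair_mem⟩ := by
    rw [← hB.continuousLinearEquivOfBilin_apply]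
    simp [v]
  have k1 : B v ⟨hφ.pair, hφ.pair_mem⟩ = ∫ x in D, inner ℝ ((v : PairL2 D).snd x) (∇ φ x) := by
    change inner ℝ (v : PairL2 D).snd (hφ.memLp_gradient.toLp (∇ φ)) = _
    rw [L2.inner_def]
    refine integral_congr_ae ?_
    filter_upwards [hφ.memLp_gradient.coeFn_toLp] with x hx
    rw [hx]
  have k2 : F ⟨hφ.pair, hφ.pair_mem⟩ = ∫ x in D, f x * φ x := by
    change inner ℝ (hf.toLp f) (hφ.memLp.toLp φ) = _
    rw [L2.inner_def]
    refine integral_congr_ae ?_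
    filter_upwards [hφ.memLp.coeFn_toLp, hf.coeFn_toLp] with x hx hx'
    rw [hx, hx']
    simp [mul_comm]
  rw [← k1, ← k2, key]

/-- For bounded `D` and `f ∈ L²(D)`, `dirichletSolution D f` is a solution. -/
theorem isDirichletSolution_dirichletSolution {f : R4 → ℝ} (hD : Bornology.IsBounded D)
    (hf : MemLp f 2 (volume.restrict D)) : IsDirichletSolution D f (dirichletSolution D f) := by
  have h := exists_isDirichletSolution hD hf
  rw [dirichletSolution, dif_pos h]
  exact h.choose_spec

/-- On bounded `D` two solutions agree almost everywhere. -/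
theorem IsDirichletSolution.ae_eq {f W W' : R4 → ℝ} (hD : Bornology.IsBounded D)
    (h : IsDirichletSolution D f W) (h' : IsDirichletSolution D f W') :
    W =ᵐ[volume.restrict D] W' := by
  obtain ⟨C, hC0, hC⟩ := H10Space.exists_poincare hD
  obtain ⟨G, hG, e⟩ := h
  obtain ⟨G', hG', e'⟩ := h'
  have hm := (H10Space D).sub_mem hG.pair_mem hG'.pair_mem
  set p : PairL2 D := WithLp.toLp 2 (hG.1.toLp W, hG.2.1.toLp G)
    - WithLp.toLp 2 (hG'.1.toLp W', hG'.2.1.toLp G') with hp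
  have p1 : p.fst = hG.1.toLp W - hG'.1.toLp W' := rfl
  have p2 : p.snd = hG.2.1.toLp G - hG'.2.1.toLp G' := rfl
  have orth : ∀ q ∈ H10Space D, inner ℝ p.snd q.snd = 0 := by
    intro q hq
    refine closure_minimal (t := {q : PairL2 D | inner ℝ p.snd q.snd = 0}) ?_ ?_ hq
    · rintro _ ⟨φ, hφ, rfl⟩
      change inner ℝ p.snd (hφ.memLp_gradient.toLp (∇ φ)) = 0
      have aux : ∀ {K : R4 → R4} (hK : MemLp K 2 (volume.restrict D)),
          inner ℝ (hK.toLp K) (hφ.memLp_gradient.toLp (∇ φ)) = ∫ x in D, inner ℝ (K x) (∇ φ x) := by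
        intro K hK
        rw [L2.inner_def]
        refine integral_congr_ae ?_
        filter_upwards [hφ.memLp_gradient.coeFn_toLp, hK.coeFn_toLp] with x hx hx'
        rw [hx, hx']
      rw [p2, inner_sub_left, aux, aux, e φ hφ, e' φ hφ, sub_self]
    · exact isClosed_eq (by fun_prop) continuous_const
  have z2 : p.snd = 0 := inner_self_eq_zero.1 (orth p hm)
  have z1 : p.fst = 0 := by
    have := hC p hm
    rw [z2, norm_zero, mul_zero] at this
    exact norm_le_zero_iff.1 this
  exact (MemLp.toLp_eq_toLp_iff hG.1 hG'.1).1 (sub_eq_zero.1 (p1 ▸ z1))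

/-- The projection of a bubble solves its defining problem. -/
theorem isDirichletSolution_projBubble {Ω : Set R4} (hΩ : Bornology.IsBounded Ω) {ε δ : ℝ}
    (hδ : 0 < δ) :
    IsDirichletSolution (holedDomain Ω ε) (fun x => bubble δ x ^ 3) (projBubble Ω ε δ) := by
  have hD : Bornology.IsBounded (holedDomain Ω ε) := hΩ.subset sdiff_subset
  refine isDirichletSolution_dirichletSolution hD ?_
  have hc : Continuous (fun x : R4 => bubble δ x ^ 3) := by
    unfold bubble
    exact (continuous_const.mul (continuous_const.div (by fun_prop) fun x => by positivity)).pow 3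
  have hK : IsCompact (closure (holedDomain Ω ε)) := hD.isCompact_closure
  have : IsFiniteMeasure (volume.restrict (holedDomain Ω ε)) :=
    ⟨by simpa using (measure_mono subset_closure).trans_lt hK.measure_lt_top⟩
  obtain ⟨M, hM⟩ := hK.exists_bound_of_continuousOn hc.continuousOn
  refine MemLp.of_bound hc.aestronglyMeasurable M ?_
  have hcl : ∀ᵐ x ∂(volume.restrict (closure (holedDomain Ω ε))), x ∈ closure (holedDomain Ω ε) :=
    ae_restrict_mem isClosed_closure.measurableSet
  filter_upwards [ae_mono (Measure.restrict_mono subset_closure le_rfl) hcl] with x hx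
  exact hM x hx

end Existence

/-! Write `A = δ_i`, `B = δ_j`, so that `ε ≪ A ≪ B ≪ 1`. The integral lives on the annulus `A ≪ |x|
≪ B`, where `U_A ≈ α₄ A / |x|²` and `U_B ≈ α₄ / B`; there the integrand is `α₄⁴ (A/B)² |x|⁻⁴`, and
the radial integral of `t³ · t⁻⁴` produces `log (B/A)`. All else contributes `O((A/B)²)`, which is
negligible because the logarithm diverges.

Replacing `P_ε U` by `U` needs only pointwise barriers, supplied by the weak comparison principle
(`IsDirichletSolution.ge_of_subsolution` and its mirror image). In dimension four `|x|⁻²` is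
harmonic off the origin, so subtracting a constant and a multiple of `|x|⁻²` from `U_δ` leaves its
Laplacian unchanged. This gives `0 ≤ P_ε U_δ ≤ U_δ` and the lower bound `le_projBubble`.

The upper bound integrates `U_A² U_B²` over the whole space (`integral_interactionDensity_le`); the
lower bound keeps only the annulus `M A < |x| < B / M` (`le_integral_projBubble_sq_mul`). Both
depend on the parameters only through the smallness of `B`, `ε / A` and `A / B`, which
`eventually_rate_le` provides uniformly on `X_η`. -/

/-- A smooth, `1`-Lipschitz substitute for the positive part: it vanishes on `(-∞, 0]`, is positive
on `(0, ∞)`, and its derivative takes values in `[0, 1]`. -/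
noncomputable def smoothPosPart (t : ℝ) : ℝ := ∫ s in (0 : ℝ)..t, Real.smoothTransition s

namespace smoothPosPart

lemma hasDerivAt (t : ℝ) : HasDerivAt smoothPosPart (Real.smoothTransition t) t :=
  intervalIntegral.integral_hasDerivAt_right
    (Real.smoothTransition.continuous.intervalIntegrable _ _)
    (Real.smoothTransition.continuous.stronglyMeasurableAtFilter _ _)
    Real.smoothTransition.continuousAt

lemma deriv_eq : deriv smoothPosPart = Real.smoothTransition :=
  funext fun t => (hasDerivAt t).deriv

lemma contDiff : ContDiff ℝ ∞ smoothPosPart := by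
  rw [contDiff_infty_iff_deriv, deriv_eq]
  exact ⟨fun t => (hasDerivAt t).differentiableAt, Real.smoothTransition.contDiff⟩

lemma lipschitz : LipschitzWith 1 smoothPosPart := by
  refine lipschitzWith_of_nnnorm_deriv_le (fun t => (hasDerivAt t).differentiableAt) fun t => ?_
  rw [deriv_eq, ← NNReal.coe_le_coe, coe_nnnorm, Real.norm_eq_abs,
    abs_of_nonneg (Real.smoothTransition.nonneg t)]
  exact Real.smoothTransition.le_one t

lemma pos {t : ℝ} (ht : 0 < t) : 0 < smoothPosPart t :=
  intervalIntegral.intervalIntegral_pos_of_pos_on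
    (Real.smoothTransition.continuous.intervalIntegrable _ _)
    (fun _ hx => Real.smoothTransition.pos_of_pos hx.1) ht

lemma eq_zero {t : ℝ} (ht : t ≤ 0) : smoothPosPart t = 0 := by
  rw [smoothPosPart, intervalIntegral.integral_congr (g := fun _ => (0 : ℝ))]
  · simp
  · intro x hx
    rw [uIcc_of_ge ht] at hx
    exact Real.smoothTransition.zero_of_nonpos hx.2

lemma nonneg (t : ℝ) : 0 ≤ smoothPosPart t := by
  rcases le_or_gt t 0 with h | h
  · exact (eq_zero h).ge
  · exact (pos h).le

end smoothPosPart

/-! ### Pairings in L² -/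

section L2
variable {α E : Type*} [MeasurableSpace α] {μ : Measure α} [NormedAddCommGroup E]
  [InnerProductSpace ℝ E]

lemma MeasureTheory.MemLp.integrable_real_inner {F G : α → E} (hF : MemLp F 2 μ)
    (hG : MemLp G 2 μ) : Integrable (fun x => inner ℝ (F x) (G x)) μ := by
  refine (L2.integrable_inner (𝕜 := ℝ) (hF.toLp F) (hG.toLp G)).congr ?_
  filter_upwards [hF.coeFn_toLp, hG.coeFn_toLp] with x hx hx'
  rw [hx, hx']

lemma MeasureTheory.MemLp.inner_toLp {F G : α → E} (hF : MemLp F 2 μ) (hG : MemLp G 2 μ) :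
    inner ℝ (hF.toLp F) (hG.toLp G) = ∫ x, inner ℝ (F x) (G x) ∂μ := by
  rw [L2.inner_def]
  refine integral_congr_ae ?_
  filter_upwards [hF.coeFn_toLp, hG.coeFn_toLp] with x hx hx'
  rw [hx, hx']

/-- Cauchy–Schwarz, followed by cancelling one factor of the norm of `F`. It turns the energy
inequality of the comparison argument into a norm estimate. -/
lemma eLpNorm_le_of_integral_norm_sq_le_inner {F G : α → E} (hF : MemLp F 2 μ)
    (hG : MemLp G 2 μ) (h : ∫ x, inner ℝ (F x) (F x) ∂μ ≤ ∫ x, inner ℝ (G x) (F x) ∂μ) :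
    eLpNorm F 2 μ ≤ eLpNorm G 2 μ := by
  rw [← hF.inner_toLp hF, ← hG.inner_toLp hF, real_inner_self_eq_norm_sq] at h
  have h1 := h.trans (real_inner_le_norm _ _)
  have h2 : ‖hF.toLp F‖ ≤ ‖hG.toLp G‖ := by
    by_contra! hlt
    have := (norm_nonneg (hG.toLp G)).trans_lt hlt
    nlinarith
  rw [Lp.norm_toLp, Lp.norm_toLp] at h2
  exact (ENNReal.toReal_le_toReal hF.eLpNorm_ne_top hG.eLpNorm_ne_top).1 h2

end L2

/-! ### Weak comparison principle -/

section Comparison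
variable {D V : Set R4} {f v W φ : R4 → ℝ}

/-- The test function `(v - s - φ)₊`, smoothed, extended by zero outside `D`. -/
noncomputable def truncation (D : Set R4) (v φ : R4 → ℝ) (s : ℝ) : R4 → ℝ :=
  D.indicator fun x => smoothPosPart (v x - s - φ x)

/-- The shift `s > 0` is what gives compact support: near a frontier point `v < s` by continuity
while `φ` vanishes, so the argument of `smoothPosPart` is negative. No regularity of the boundary is
needed. -/
lemma truncation_eventuallyEq_zero (hV : IsOpen V) (hDV : closure D ⊆ V)
    (hv : ContDiffOn ℝ ∞ v V) (hDo : IsOpen D) (hfr : ∀ x ∈ frontier D, v x ≤ 0) {s : ℝ}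
    (hs : 0 < s) (hφ : IsTestFunction D φ) {x : R4} (hx : x ∉ D) :
    truncation D v φ s =ᶠ[𝓝 x] 0 := by
  by_cases hc : x ∈ closure D
  · have hxf : x ∈ frontier D := by rw [hDo.frontier_eq]; exact ⟨hc, hx⟩
    have hcont : ContinuousAt v x :=
      hv.continuousOn.continuousAt (hV.mem_nhds (hDV hc))
    have h1 : ∀ᶠ y in 𝓝 x, v y < s := hcont.eventually_lt_const ((hfr x hxf).trans_lt hs)
    have h2 : φ =ᶠ[𝓝 x] 0 := notMem_tsupport_iff_eventuallyEq.1 fun h => hx (hφ.2.2 h)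
    filter_upwards [h1, h2] with y hy1 hy2
    by_cases hyD : y ∈ D
    · rw [truncation, indicator_of_mem hyD, hy2]
      exact smoothPosPart.eq_zero (by simp only [Pi.zero_apply]; linarith)
    · exact indicator_of_notMem hyD _
  · filter_upwards [isClosed_closure.isOpen_compl.mem_nhds hc] with y hy
    exact indicator_of_notMem (fun h => hy (subset_closure h)) _

lemma truncation_eventuallyEq (hDo : IsOpen D) (s : ℝ) {x : R4} (hx : x ∈ D) :
    truncation D v φ s =ᶠ[𝓝 x] fun y => smoothPosPart (v y - s - φ y) := by
  filter_upwards [hDo.mem_nhds hx] with y hy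
  exact indicator_of_mem hy _

lemma isTestFunction_truncation (hDo : IsOpen D) (hDb : Bornology.IsBounded D) (hV : IsOpen V)
    (hDV : closure D ⊆ V) (hv : ContDiffOn ℝ ∞ v V) (hfr : ∀ x ∈ frontier D, v x ≤ 0) {s : ℝ}
    (hs : 0 < s) (hφ : IsTestFunction D φ) : IsTestFunction D (truncation D v φ s) := by
  have h0 : ∀ x ∉ D, truncation D v φ s =ᶠ[𝓝 x] 0 := fun x hx =>
    truncation_eventuallyEq_zero hV hDV hv hDo hfr hs hφ hx
  have hsub : tsupport (truncation D v φ s) ⊆ D := fun x hx => by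
    by_contra hxD
    exact notMem_tsupport_iff_eventuallyEq.2 (h0 x hxD) hx
  refine ⟨contDiff_iff_contDiffAt.2 fun x => ?_, ?_, hsub⟩
  · by_cases hx : x ∈ D
    · have hvx : ContDiffAt ℝ ∞ v x := hv.contDiffAt (hV.mem_nhds (hDV (subset_closure hx)))
      exact (smoothPosPart.contDiff.contDiffAt.comp x
        ((hvx.sub contDiffAt_const).sub hφ.1.contDiffAt)).congr_of_eventuallyEq
        (truncation_eventuallyEq hDo s hx)
    · exact (contDiffAt_const (c := (0 : ℝ))).congr_of_eventuallyEq (h0 x hx)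
  · exact Metric.isCompact_of_isClosed_isBounded (isClosed_tsupport _) (hDb.subset hsub)

lemma gradient_truncation (hDo : IsOpen D) {x : R4} (hx : x ∈ D) (hv : DifferentiableAt ℝ v x)
    (hφ : DifferentiableAt ℝ φ x) (s : ℝ) :
    ∇ (truncation D v φ s) x =
      Real.smoothTransition (v x - s - φ x) • (∇ v x - ∇ φ x) := by
  rw [(truncation_eventuallyEq hDo s hx).gradient_eq]
  apply HasGradientAt.gradient
  rw [hasGradientAt_iff_hasFDerivAt, map_smul, map_sub]
  exact (smoothPosPart.hasDerivAt (v x - s - φ x)).comp_hasFDerivAt x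
    ((hv.hasGradientAt.hasFDerivAt.sub_const s).sub hφ.hasGradientAt.hasFDerivAt)

lemma memLp_gradient_of_contDiffOn (hDo : IsOpen D) (hDb : Bornology.IsBounded D) (hV : IsOpen V)
    (hDV : closure D ⊆ V) (hv : ContDiffOn ℝ ∞ v V) : MemLp (∇ v) 2 (volume.restrict D) := by
  have hK : IsCompact (closure D) := hDb.isCompact_closure
  have : IsFiniteMeasure (volume.restrict D) :=
    ⟨by simpa using (measure_mono subset_closure).trans_lt hK.measure_lt_top⟩
  have hc : ContinuousOn (∇ v) V :=
    (LinearIsometryEquiv.continuous (InnerProductSpace.toDual ℝ R4).symm).comp_continuousOn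
      (hv.continuousOn_fderiv_of_isOpen hV (by simp))
  obtain ⟨M, hM⟩ := hK.exists_bound_of_continuousOn (hc.mono hDV)
  refine MemLp.of_bound
    ((hc.mono (subset_closure.trans hDV)).aestronglyMeasurable hDo.measurableSet) M ?_
  filter_upwards [ae_restrict_mem hDo.measurableSet] with x hx
  exact hM x (subset_closure hx)

/-- Weak comparison principle: a smooth subsolution that is nonpositive on the boundary lies below
the solution of the Dirichlet problem. -/
theorem IsDirichletSolution.ge_of_subsolution (hW : IsDirichletSolution D f W) (hDo : IsOpen D)
    (hDb : Bornology.IsBounded D) (hV : IsOpen V)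
    (hDV : closure D ⊆ V) (hv : ContDiffOn ℝ ∞ v V) (hfr : ∀ x ∈ frontier D, v x ≤ 0)
    (hsub : ∀ ψ, IsTestFunction D ψ → 0 ≤ ψ →
      ∫ x in D, inner ℝ (∇ v x) (∇ ψ x) ≤ ∫ x in D, f x * ψ x) :
    v ≤ᵐ[volume.restrict D] W := by
  obtain ⟨C, hC⟩ := IsTestFunction.exists_poincare hDb
  obtain ⟨G, ⟨hWL, hGL, φ, hφ, hφW, hφG⟩, hsol⟩ := hW
  have hvL : MemLp (∇ v) 2 (volume.restrict D) := memLp_gradient_of_contDiffOn hDo hDb hV hDV hv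
  have hvm : AEStronglyMeasurable v (volume.restrict D) :=
    (hv.continuousOn.mono (subset_closure.trans hDV)).aestronglyMeasurable hDo.measurableSet
  have hvd : ∀ x ∈ D, DifferentiableAt ℝ v x := fun x hx =>
    (hv.contDiffAt (hV.mem_nhds (hDV (subset_closure hx)))).differentiableAt (by simp)
  have key : ∀ s : ℝ, 0 < s → ∀ᵐ x ∂(volume.restrict D), v x - s ≤ W x := by
    intro s hs
    set ψ : ℕ → R4 → ℝ := fun n => truncation D v (φ n) s with hψdef
    have hψ : ∀ n, IsTestFunction D (ψ n) := fun n =>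
      isTestFunction_truncation hDo hDb hV hDV hv hfr hs (hφ n)
    have hgrad : ∀ n, ∀ x ∈ D, ∇ (ψ n) x =
        Real.smoothTransition (v x - s - φ n x) • (∇ v x - ∇ (φ n) x) := fun n x hx =>
      gradient_truncation hDo hx (hvd x hx) ((hφ n).1.differentiable (by simp) x) s
    have hψ0 : ∀ n, 0 ≤ ψ n := fun n x => indicator_nonneg (fun _ _ => smoothPosPart.nonneg _) x
    -- Energy estimate: `∇ψₙ = θ (∇v - ∇φₙ)` with `θ ∈ [0, 1]`, so `|∇ψₙ|² ≤ ⟨∇v - ∇φₙ, ∇ψₙ⟩`. After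
    -- integration the subsolution property and the equation replace `∇v` by `G`.
    have h1 : ∀ n, eLpNorm (∇ (ψ n)) 2 (volume.restrict D)
        ≤ eLpNorm (∇ (φ n) - G) 2 (volume.restrict D) := by
      intro n
      have hψL := (hψ n).memLp_gradient
      have hφL := (hφ n).memLp_gradient
      have e : eLpNorm (∇ (φ n) - G) 2 (volume.restrict D)
          = eLpNorm (G - ∇ (φ n)) 2 (volume.restrict D) := eLpNorm_sub_comm _ _ _ _
      rw [e]
      refine eLpNorm_le_of_integral_norm_sq_le_inner hψL (hGL.sub hφL) ?_
      have a1 : ∫ x in D, inner ℝ (∇ (ψ n) x) (∇ (ψ n) x)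
          ≤ ∫ x in D, inner ℝ (∇ v x - ∇ (φ n) x) (∇ (ψ n) x) := by
        refine integral_mono_ae (hψL.integrable_real_inner hψL)
          ((hvL.sub hφL).integrable_real_inner hψL) ?_
        filter_upwards [ae_restrict_mem hDo.measurableSet] with x hx
        rw [hgrad n x hx, real_inner_smul_left]
        refine mul_le_of_le_one_left ?_ (Real.smoothTransition.le_one _)
        rw [real_inner_smul_right]
        exact mul_nonneg (Real.smoothTransition.nonneg _) real_inner_self_nonneg
      have a2 : ∫ x in D, inner ℝ (∇ v x) (∇ (ψ n) x) ≤ ∫ x in D, inner ℝ (G x) (∇ (ψ n) x) := by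
        rw [hsol _ (hψ n)]
        exact hsub _ (hψ n) (hψ0 n)
      refine a1.trans ?_
      simp only [Pi.sub_apply, inner_sub_left]
      rw [integral_sub (hvL.integrable_real_inner hψL) (hφL.integrable_real_inner hψL),
        integral_sub (hGL.integrable_real_inner hψL) (hφL.integrable_real_inner hψL)]
      linarith
    set β : R4 → ℝ := fun x => smoothPosPart (v x - s - W x) with hβ
    have hβm : AEStronglyMeasurable β (volume.restrict D) :=
      smoothPosPart.contDiff.continuous.comp_aestronglyMeasurable
        ((hvm.sub aestronglyMeasurable_const).sub hWL.1)
    have h2 : ∀ n, eLpNorm (β - ψ n) 2 (volume.restrict D)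
        ≤ eLpNorm (φ n - W) 2 (volume.restrict D) := by
      intro n
      refine eLpNorm_mono_ae ?_
      filter_upwards [ae_restrict_mem hDo.measurableSet] with x hx
      have := smoothPosPart.lipschitz.dist_le_mul (v x - s - W x) (v x - s - φ n x)
      rw [Real.dist_eq, Real.dist_eq, NNReal.coe_one, one_mul] at this
      simp only [hβ, hψdef, truncation, Pi.sub_apply, indicator_of_mem hx, Real.norm_eq_abs]
      refine this.trans (le_of_eq ?_)
      congr 1
      ring
    -- The Lipschitz bound controls `β - ψₙ`, and Poincaré with the energy estimate controls `ψₙ`.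
    -- Both bounds tend to zero, so `β` vanishes almost everywhere.
    have h3 : ∀ n, eLpNorm β 2 (volume.restrict D)
        ≤ eLpNorm (φ n - W) 2 (volume.restrict D)
          + C * eLpNorm (∇ (φ n) - G) 2 (volume.restrict D) := by
      intro n
      calc eLpNorm β 2 (volume.restrict D)
          = eLpNorm ((β - ψ n) + ψ n) 2 (volume.restrict D) := by rw [sub_add_cancel]
        _ ≤ eLpNorm (β - ψ n) 2 (volume.restrict D) + eLpNorm (ψ n) 2 (volume.restrict D) :=
            eLpNorm_add_le (hβm.sub (hψ n).memLp.1) (hψ n).memLp.1 (by norm_num)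
        _ ≤ _ := add_le_add (h2 n) ((hC _ (hψ n)).trans (by gcongr; exact h1 n))
    have h4 : Tendsto (fun n => eLpNorm (φ n - W) 2 (volume.restrict D)
          + C * eLpNorm (∇ (φ n) - G) 2 (volume.restrict D)) atTop (𝓝 0) := by
      have := hφW.add (ENNReal.Tendsto.const_mul (a := (C : ENNReal)) hφG
        (Or.inr ENNReal.coe_ne_top))
      simpa using this
    have h5 : eLpNorm β 2 (volume.restrict D) = 0 :=
      le_antisymm (ge_of_tendsto' h4 h3) zero_le
    rw [eLpNorm_eq_zero_iff hβm (by norm_num)] at h5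
    filter_upwards [h5] with x hx
    by_contra! hlt
    exact (smoothPosPart.pos (t := v x - s - W x) (by linarith)).ne' hx
  -- Countably many shifts suffice to let `s → 0` off a single null set.
  have hall : ∀ᵐ x ∂(volume.restrict D), ∀ n : ℕ, v x - 1 / ((n : ℝ) + 1) ≤ W x :=
    ae_all_iff.2 fun n => key _ (by positivity)
  filter_upwards [hall] with x hx
  refine le_of_forall_pos_le_add fun s hs => ?_
  obtain ⟨n, hn⟩ := exists_nat_one_div_lt hs
  linarith [hx n]

lemma IsTestFunction.neg (h : IsTestFunction D φ) : IsTestFunction D (-φ) := by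
  simpa using h.smul (-1)

lemma gradient_neg (φ : R4 → ℝ) : ∇ (-φ) = -∇ φ := by
  ext1 x
  simp only [gradient, Pi.neg_apply, fderiv_neg, map_neg]

lemma IsDirichletSolution.neg (hW : IsDirichletSolution D f W) :
    IsDirichletSolution D (-f) (-W) := by
  obtain ⟨G, ⟨hWL, hGL, φ, hφ, hφW, hφG⟩, hsol⟩ := hW
  refine ⟨-G, ⟨hWL.neg, hGL.neg, fun n => -φ n, fun n => (hφ n).neg, ?_, ?_⟩, fun ψ hψ => ?_⟩
  · refine hφW.congr fun n => ?_
    rw [← eLpNorm_neg]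
    congr 1
    ring
  · refine hφG.congr fun n => ?_
    rw [← eLpNorm_neg, gradient_neg]
    congr 1
    abel
  · simp only [Pi.neg_apply, inner_neg_left, neg_mul, integral_neg]
    rw [hsol ψ hψ]

/-- Weak comparison principle: a smooth supersolution that is nonnegative on the boundary lies
above the solution of the Dirichlet problem. -/
theorem IsDirichletSolution.le_of_supersolution (hW : IsDirichletSolution D f W) (hDo : IsOpen D)
    (hDb : Bornology.IsBounded D) (hV : IsOpen V)
    (hDV : closure D ⊆ V) (hv : ContDiffOn ℝ ∞ v V) (hfr : ∀ x ∈ frontier D, 0 ≤ v x)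
    (hsup : ∀ ψ, IsTestFunction D ψ → 0 ≤ ψ →
      ∫ x in D, f x * ψ x ≤ ∫ x in D, inner ℝ (∇ v x) (∇ ψ x)) :
    W ≤ᵐ[volume.restrict D] v := by
  have h := hW.neg.ge_of_subsolution hDo hDb hV hDV hv.neg
    (fun x hx => neg_nonpos.2 (hfr x hx)) fun ψ hψ h0 => by
      have e : (fun y => -v y) = -v := rfl
      rw [e, gradient_neg]
      simp only [Pi.neg_apply, inner_neg_left, neg_mul, integral_neg]
      exact neg_le_neg (hsup ψ hψ h0)
  filter_upwards [h] with x hx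
  exact neg_le_neg_iff.1 hx

end Comparison

/-! ### The weak Laplacian of `1 / (a + |x|²)` -/

section InvQuad
variable {D : Set R4} {ψ : R4 → ℝ}

/-- The function `x ↦ 1 / (a + |x|²)`. -/
noncomputable def invQuad (a : ℝ) (x : R4) : ℝ := (a + ‖x‖ ^ 2)⁻¹

lemma invQuad_nonneg {a : ℝ} (ha : 0 ≤ a) (x : R4) : 0 ≤ invQuad a x := by
  unfold invQuad; positivity

lemma contDiffAt_invQuad {a : ℝ} {x : R4} (hx : a + ‖x‖ ^ 2 ≠ 0) {n : WithTop ℕ∞} :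
    ContDiffAt ℝ n (invQuad a) x :=
  (contDiffAt_const.add (contDiffAt_id.norm_sq ℝ)).inv hx

lemma hasGradientAt_invQuad {a : ℝ} {x : R4} (hx : a + ‖x‖ ^ 2 ≠ 0) :
    HasGradientAt (invQuad a) (-(2 * invQuad a x ^ 2) • x) x := by
  rw [hasGradientAt_iff_hasFDerivAt]
  have h := ((hasStrictFDerivAt_norm_sq x).hasFDerivAt.const_add a)
  have h2 := (hasDerivAt_inv hx).comp_hasFDerivAt x h
  refine h2.congr_fderiv ?_
  ext y
  simp only [invQuad, smul_apply, InnerProductSpace.toDual_apply_apply,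
    innerSL_apply_apply, real_inner_smul_left, smul_eq_mul, nsmul_eq_mul, Nat.cast_ofNat, inv_pow]
  ring

/-- Continuity of `g` is asked only on the support of `ψ`, so that `g` may be singular at the
origin, as happens for `a = 0`. -/
lemma integrable_mul_of_hasCompactSupport (hψ : Continuous ψ)
    (hc : HasCompactSupport ψ) {g : R4 → ℝ} (hg : ContinuousOn g (tsupport ψ)) :
    Integrable fun x => ψ x * g x := by
  rw [← integrableOn_iff_integrable_of_support_subset (s := tsupport ψ)]
  · exact (hψ.continuousOn.mul hg).integrableOn_compact hc
  · intro x hx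
    exact subset_tsupport ψ fun h => hx (by simp [h])

/-- In the weak sense, `-Δ (1 / (a + |x|²)) = 8 a / (a + |x|²)³` away from the origin. -/
lemma integral_inner_gradient_invQuad {a : ℝ} (ha : 0 ≤ a) (hD : (0 : R4) ∉ D)
    (hψ : IsTestFunction D ψ) :
    ∫ x in D, inner ℝ (∇ (invQuad a) x) (∇ ψ x) = ∫ x in D, 8 * a * invQuad a x ^ 3 * ψ x := by
  have hne : ∀ x ∈ tsupport ψ, a + ‖x‖ ^ 2 ≠ 0 := fun x hx => by
    have : x ≠ 0 := fun h => hD (h ▸ hψ.2.2 hx)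
    positivity
  have hcq : ContinuousOn (invQuad a) (tsupport ψ) := fun x hx =>
    (contDiffAt_invQuad (hne x hx) (n := 0)).continuousAt.continuousWithinAt
  have hci : ∀ i, Continuous fun x : R4 => x i := fun i => by fun_prop
  have hcψ : ∀ i, Continuous fun x => fderiv ℝ ψ x (EuclideanSpace.single i 1) := fun i =>
    (hψ.1.continuous_fderiv (by simp)).clm_apply continuous_const
  -- The components of `∇ (invQuad a)`; the integration by parts is done one coordinate at a time.
  let g : Fin 4 → R4 → ℝ := fun i x => -2 * invQuad a x ^ 2 * x i
  have hgd : ∀ i, ∀ x ∈ tsupport ψ, ∃ g' : R4 →L[ℝ] ℝ, HasFDerivAt (g i) g' x ∧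
      g' (EuclideanSpace.single i 1) = 8 * invQuad a x ^ 3 * x i ^ 2 - 2 * invQuad a x ^ 2 := by
    intro i x hx
    have h1 := (hasGradientAt_invQuad (hne x hx)).hasFDerivAt
    have h2 : HasFDerivAt (fun y : R4 => y i) (EuclideanSpace.proj i : R4 →L[ℝ] ℝ) x :=
      (EuclideanSpace.proj i : R4 →L[ℝ] ℝ).hasFDerivAt
    refine ⟨_, ((h1.pow 2).const_mul (-2)).mul h2, ?_⟩
    simp [EuclideanSpace.inner_single_right]
    ring
  have hsupp' : ∀ x, x ∉ tsupport ψ → fderiv ℝ ψ x = 0 := fun x hx =>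
    image_eq_zero_of_notMem_tsupport fun h => hx (tsupport_fderiv_subset ℝ h)
  have hint1 : ∀ i, Integrable fun x => ψ x *
      (8 * invQuad a x ^ 3 * x i ^ 2 - 2 * invQuad a x ^ 2) := fun i =>
    integrable_mul_of_hasCompactSupport hψ.1.continuous hψ.2.1
      (((continuousOn_const.mul (hcq.pow 3)).mul ((hci i).pow 2).continuousOn).sub
        (continuousOn_const.mul (hcq.pow 2)))
  have hcg : ∀ i, ContinuousOn (g i) (tsupport ψ) := fun i =>
    (continuousOn_const.mul (hcq.pow 2)).mul (hci i).continuousOn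
  have hcs : ∀ i, tsupport (fun x => fderiv ℝ ψ x (EuclideanSpace.single i 1)) ⊆ tsupport ψ :=
    fun i => closure_minimal (fun x hx => by
      by_contra h
      exact hx (by simp [hsupp' x h])) (isClosed_tsupport _)
  have hint2 : ∀ i, Integrable fun x => fderiv ℝ ψ x (EuclideanSpace.single i 1) * g i x :=
    fun i => integrable_mul_of_hasCompactSupport (hcψ i)
      (hψ.2.1.of_isClosed_subset (isClosed_tsupport _) (hcs i)) ((hcg i).mono (hcs i))
  have hpt : ∀ i x, ψ x * fderiv ℝ (g i) x (EuclideanSpace.single i 1)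
      = ψ x * (8 * invQuad a x ^ 3 * x i ^ 2 - 2 * invQuad a x ^ 2) := by
    intro i x
    by_cases hx : x ∈ tsupport ψ
    · obtain ⟨g', h1, h2⟩ := hgd i x hx
      rw [h1.fderiv, h2]
    · rw [image_eq_zero_of_notMem_tsupport hx, zero_mul, zero_mul]
  have hibp : ∀ i, ∫ x, ψ x * (8 * invQuad a x ^ 3 * x i ^ 2 - 2 * invQuad a x ^ 2)
      = -∫ x, fderiv ℝ ψ x (EuclideanSpace.single i 1) * g i x := by
    intro i
    rw [← integral_mul_fderiv_eq_neg_fderiv_mul_of_integrable (hint2 i)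
      ((hint1 i).congr (ae_of_all _ fun x => (hpt i x).symm))
      (integrable_mul_of_hasCompactSupport hψ.1.continuous hψ.2.1 (hcg i))
      (fun x _ => hψ.1.differentiable (by simp) x)
      (fun x hx => (hgd i x hx).choose_spec.1.differentiableAt)]
    exact integral_congr_ae (ae_of_all _ fun x => (hpt i x).symm)
  have hL : ∀ x, inner ℝ (∇ (invQuad a) x) (∇ ψ x)
      = ∑ i, fderiv ℝ ψ x (EuclideanSpace.single i 1) * g i x := by
    intro x
    by_cases hx : x ∈ tsupport ψ
    · have hcoord : ∀ i, (∇ ψ x) i = fderiv ℝ ψ x (EuclideanSpace.single i 1) := fun i => by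
        rw [← inner_gradient_left, EuclideanSpace.inner_single_right]
        simp
      rw [(hasGradientAt_invQuad (hne x hx)).gradient, PiLp.inner_apply]
      refine Finset.sum_congr rfl fun i _ => ?_
      simp only [hcoord, g, PiLp.smul_apply, smul_eq_mul, RCLike.inner_apply, conj_trivial]
      ring
    · simp [gradient, hsupp' x hx]
  -- With `q = invQuad a x`, the sum over four coordinates is `8 q² - 8 q³ |x|² = 8 a q³`, because
  -- `q (a + |x|²) = 1`. The dimension enters here.
  have hR : ∀ x, 8 * a * invQuad a x ^ 3 * ψ x
      = ∑ i, -(ψ x * (8 * invQuad a x ^ 3 * x i ^ 2 - 2 * invQuad a x ^ 2)) := by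
    intro x
    by_cases hx : x ∈ tsupport ψ
    · have e : invQuad a x * (a + ‖x‖ ^ 2) = 1 := inv_mul_cancel₀ (hne x hx)
      rw [EuclideanSpace.real_norm_sq_eq, Fin.sum_univ_four] at e
      rw [Fin.sum_univ_four]
      linear_combination (8 * ψ x * invQuad a x ^ 2) * e
    · simp [image_eq_zero_of_notMem_tsupport hx]
  have hout : ∀ x, x ∉ D → x ∉ tsupport ψ := fun x hx h => hx (hψ.2.2 h)
  rw [setIntegral_eq_integral_of_forall_compl_eq_zero fun x hx => by
      simp [gradient, hsupp' x (hout x hx)],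
    setIntegral_eq_integral_of_forall_compl_eq_zero fun x hx => by
      rw [image_eq_zero_of_notMem_tsupport (hout x hx), mul_zero]]
  simp only [hL, hR]
  rw [integral_finsetSum _ fun i _ => hint2 i, integral_finsetSum _ fun i _ => (hint1 i).fun_neg]
  refine Finset.sum_congr rfl fun i _ => ?_
  rw [integral_neg, hibp i, neg_neg]

end InvQuad

/-! ### Barriers for the projected bubble -/

section ProjBubble
variable {Ω : Set R4} {ε δ : ℝ}

lemma alpha4_pos : 0 < alpha4 := by unfold alpha4; positivity

lemma alpha4_sq : alpha4 ^ 2 = 8 := by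
  rw [alpha4, mul_pow, Real.sq_sqrt (by norm_num)]; norm_num

lemma bubble_eq_invQuad (δ : ℝ) (x : R4) : bubble δ x = alpha4 * δ * invQuad (δ ^ 2) x := by
  rw [bubble, invQuad]; ring

lemma bubble_nonneg (hδ : 0 < δ) (x : R4) : 0 ≤ bubble δ x := by
  have := alpha4_pos
  unfold bubble; positivity

lemma isOpen_holedDomain (hΩ : IsOpen Ω) (ε : ℝ) : IsOpen (holedDomain Ω ε) :=
  hΩ.sdiff Metric.isClosed_closedBall

lemma isBounded_holedDomain (hΩ : Bornology.IsBounded Ω) (ε : ℝ) :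
    Bornology.IsBounded (holedDomain Ω ε) := hΩ.subset sdiff_subset

lemma le_norm_of_mem_closure_holedDomain {x : R4} (hx : x ∈ closure (holedDomain Ω ε)) :
    ε ≤ ‖x‖ := by
  refine closure_minimal (t := {x : R4 | ε ≤ ‖x‖}) ?_ (isClosed_le continuous_const continuous_norm)
    hx
  intro y hy
  have := hy.2
  simp only [Metric.mem_closedBall, dist_zero_right, not_le] at this
  exact this.le

lemma closure_holedDomain_subset (hε : 0 < ε) : closure (holedDomain Ω ε) ⊆ {0}ᶜ := fun x hx => by
  have := le_norm_of_mem_closure_holedDomain hx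
  exact norm_pos_iff.1 (hε.trans_le this)

lemma contDiffOn_invQuad {a : ℝ} (ha : 0 ≤ a) : ContDiffOn ℝ ∞ (invQuad a) {0}ᶜ := fun x hx => by
  have : x ≠ 0 := hx
  exact (contDiffAt_invQuad (by positivity)).contDiffWithinAt

/-- A test function integrates `U_δ³` as it integrates `-ΔU_δ`. -/
lemma integral_inner_gradient_bubble {D : Set R4} {ψ : R4 → ℝ} (hD : (0 : R4) ∉ D)
    (hψ : IsTestFunction D ψ) :
    alpha4 * δ * ∫ x in D, inner ℝ (∇ (invQuad (δ ^ 2)) x) (∇ ψ x)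
      = ∫ x in D, bubble δ x ^ 3 * ψ x := by
  rw [integral_inner_gradient_invQuad (sq_nonneg δ) hD hψ, ← integral_const_mul]
  refine integral_congr_ae (ae_of_all _ fun x => ?_)
  simp only [bubble_eq_invQuad]
  -- The normalisation `α₄² = 8` is exactly what makes `-ΔU_δ = U_δ³`.
  linear_combination (-(alpha4 * δ ^ 3 * invQuad (δ ^ 2) x ^ 3 * ψ x)) * alpha4_sq

lemma gradient_invQuad_combination {a b : ℝ} (c₁ c₂ c₃ : ℝ) {x : R4} (ha : 0 ≤ a) (hb : 0 ≤ b)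
    (hx : x ≠ 0) : ∇ (fun y => c₁ * invQuad a y - c₂ - c₃ * invQuad b y) x
      = c₁ • ∇ (invQuad a) x - c₃ • ∇ (invQuad b) x := by
  have h1 := (hasGradientAt_invQuad (a := a) (x := x) (by positivity))
  have h2 := (hasGradientAt_invQuad (a := b) (x := x) (by positivity))
  rw [h1.gradient, h2.gradient]
  apply HasGradientAt.gradient
  rw [hasGradientAt_iff_hasFDerivAt, map_sub, map_smul _ c₁, map_smul _ c₃]
  exact ((h1.hasFDerivAt.const_mul c₁).sub_const c₂).sub (h2.hasFDerivAt.const_mul c₃)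

/-- Constants and `|x|⁻²` are harmonic away from the origin, so every such combination solves the
equation of `P_ε U_δ` weakly. Only boundary signs remain to be arranged through `c₂` and `c₃`. -/
lemma integral_inner_gradient_combination (hΩo : IsOpen Ω) (hΩb : Bornology.IsBounded Ω)
    (hε : 0 < ε) (δ c₂ c₃ : ℝ) {ψ : R4 → ℝ} (hψ : IsTestFunction (holedDomain Ω ε) ψ) :
    ∫ x in holedDomain Ω ε,
        inner ℝ (∇ (fun y => alpha4 * δ * invQuad (δ ^ 2) y - c₂ - c₃ * invQuad 0 y) x) (∇ ψ x)
      = ∫ x in holedDomain Ω ε, bubble δ x ^ 3 * ψ x := by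
  have hDo := isOpen_holedDomain hΩo ε
  have hDb := isBounded_holedDomain hΩb ε
  have hcl := closure_holedDomain_subset (Ω := Ω) hε
  have hD0 : (0 : R4) ∉ holedDomain Ω ε := fun h => hcl (subset_closure h) rfl
  have hI : ∀ {a : ℝ}, 0 ≤ a → Integrable (fun x => inner ℝ (∇ (invQuad a) x) (∇ ψ x))
      (volume.restrict (holedDomain Ω ε)) := fun ha =>
    (memLp_gradient_of_contDiffOn hDo hDb isOpen_compl_singleton hcl
      (contDiffOn_invQuad ha)).integrable_real_inner hψ.memLp_gradient
  have e : ∫ x in holedDomain Ω ε,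
        inner ℝ (∇ (fun y => alpha4 * δ * invQuad (δ ^ 2) y - c₂ - c₃ * invQuad 0 y) x) (∇ ψ x)
      = ∫ x in holedDomain Ω ε, (alpha4 * δ * inner ℝ (∇ (invQuad (δ ^ 2)) x) (∇ ψ x)
          - c₃ * inner ℝ (∇ (invQuad 0) x) (∇ ψ x)) := by
    refine setIntegral_congr_fun hDo.measurableSet fun x hx => ?_
    rw [gradient_invQuad_combination _ _ _ (sq_nonneg δ) le_rfl (hcl (subset_closure hx)),
      inner_sub_left, real_inner_smul_left, real_inner_smul_left]
  rw [e, integral_sub ((hI (sq_nonneg δ)).const_mul _) ((hI le_rfl).const_mul _),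
    integral_const_mul, integral_const_mul, integral_inner_gradient_bubble hD0 hψ,
    integral_inner_gradient_invQuad le_rfl hD0 hψ]
  simp

/-- The projected bubble is nonnegative. -/
theorem projBubble_nonneg (hΩo : IsOpen Ω) (hΩb : Bornology.IsBounded Ω) (hδ : 0 < δ) :
    ∀ᵐ x ∂(volume.restrict (holedDomain Ω ε)), 0 ≤ projBubble Ω ε δ x := by
  refine (isDirichletSolution_projBubble hΩb hδ).ge_of_subsolution (v := fun _ => 0)
    (isOpen_holedDomain hΩo ε) (isBounded_holedDomain hΩb ε) isOpen_univ (subset_univ _)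
    contDiffOn_const (fun _ _ => le_rfl) fun ψ _ h0 => ?_
  simp only [gradient_fun_const, inner_zero_left, integral_zero]
  exact integral_nonneg fun x => mul_nonneg (pow_nonneg (bubble_nonneg hδ x) 3) (h0 x)

/-- The projected bubble lies below the bubble. -/
theorem projBubble_le_bubble (hΩo : IsOpen Ω) (hΩb : Bornology.IsBounded Ω) (hε : 0 < ε)
    (hδ : 0 < δ) :
    ∀ᵐ x ∂(volume.restrict (holedDomain Ω ε)), projBubble Ω ε δ x ≤ bubble δ x := by
  have hq := contDiffOn_invQuad (sq_nonneg δ)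
  have h := (isDirichletSolution_projBubble hΩb hδ).le_of_supersolution
    (v := fun y => alpha4 * δ * invQuad (δ ^ 2) y - 0 - 0 * invQuad 0 y)
    (isOpen_holedDomain hΩo ε) (isBounded_holedDomain hΩb ε) isOpen_compl_singleton
    (closure_holedDomain_subset hε)
    (((contDiffOn_const.mul hq).sub contDiffOn_const).sub
      (contDiffOn_const.mul (contDiffOn_invQuad le_rfl)))
    (fun x _ => by
      rw [← bubble_eq_invQuad, zero_mul, sub_zero, sub_zero]
      exact bubble_nonneg hδ x)
    fun ψ hψ _ => (integral_inner_gradient_combination hΩo hΩb hε δ 0 0 hψ).ge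
  filter_upwards [h] with x hx
  simpa [bubble_eq_invQuad] using hx

/-- The projected bubble differs from the bubble by no more than explicit harmonic functions that
dominate it on the two parts of the boundary. -/
theorem le_projBubble (hΩo : IsOpen Ω) (hΩb : Bornology.IsBounded Ω) (hε : 0 < ε) (hδ : 0 < δ)
    {r : ℝ} (hr : 0 < r) (hrΩ : Metric.ball 0 r ⊆ Ω) :
    ∀ᵐ x ∂(volume.restrict (holedDomain Ω ε)),
      alpha4 * (δ / (δ ^ 2 + ‖x‖ ^ 2) - δ / r ^ 2 - ε ^ 2 / (δ * ‖x‖ ^ 2))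
        ≤ projBubble Ω ε δ x := by
  have hα := alpha4_pos
  have hq := contDiffOn_invQuad (sq_nonneg δ)
  have h := (isDirichletSolution_projBubble hΩb hδ).ge_of_subsolution
    -- The constant dominates `U_δ` where `|x| ≥ r`; the multiple of `|x|⁻²` equals `α₄ / δ`, the
    -- maximum of `U_δ`, on `|x| = ε`.
    (v := fun y => alpha4 * δ * invQuad (δ ^ 2) y - alpha4 * δ / r ^ 2
      - alpha4 * ε ^ 2 / δ * invQuad 0 y)
    (isOpen_holedDomain hΩo ε) (isBounded_holedDomain hΩb ε) isOpen_compl_singleton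
    (closure_holedDomain_subset hε)
    (((contDiffOn_const.mul hq).sub contDiffOn_const).sub
      (contDiffOn_const.mul (contDiffOn_invQuad le_rfl)))
    (fun x hx => by
      rw [(isOpen_holedDomain hΩo ε).frontier_eq] at hx
      have h1 := le_norm_of_mem_closure_holedDomain hx.1
      have hx0 : 0 < ‖x‖ := hε.trans_le h1
      have hbound : ∀ {c b : ℝ}, 0 ≤ c → 0 < b → b ≤ δ ^ 2 + ‖x‖ ^ 2 →
          c * invQuad (δ ^ 2) x ≤ c / b := fun {c b} hc hb hle => by
        rw [invQuad, ← div_eq_mul_inv]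
        exact div_le_div_of_nonneg_left hc hb hle
      -- A frontier point inside the open set `Ω` lies on the sphere `|x| = ε`; any other one is
      -- outside `B_r ⊆ Ω`.
      by_cases hxΩ : x ∈ Ω
      · have h2 : ‖x‖ ≤ ε := by
          by_contra hlt
          exact hx.2 ⟨hxΩ, by simpa using hlt⟩
        have h3 : ‖x‖ = ε := le_antisymm h2 h1
        have h4 : alpha4 * ε ^ 2 / δ * invQuad 0 x = alpha4 * δ / δ ^ 2 := by
          rw [invQuad, h3]; field_simp; ring
        have h5 : alpha4 * δ * invQuad (δ ^ 2) x ≤ alpha4 * δ / δ ^ 2 :=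
          hbound (by positivity) (by positivity) (by nlinarith [sq_nonneg ‖x‖])
        have h6 : 0 ≤ alpha4 * δ / r ^ 2 := by positivity
        linarith
      · have h2 : r ≤ ‖x‖ := by
          by_contra hlt
          exact hxΩ (hrΩ (by simpa using hlt))
        have h5 : alpha4 * δ * invQuad (δ ^ 2) x ≤ alpha4 * δ / r ^ 2 :=
          hbound (by positivity) (by positivity) (by nlinarith [sq_nonneg δ])
        have h6 : 0 ≤ alpha4 * ε ^ 2 / δ * invQuad 0 x :=
          mul_nonneg (by positivity) (invQuad_nonneg le_rfl x)
        linarith)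
    fun ψ hψ _ => (integral_inner_gradient_combination hΩo hΩb hε δ _ _ hψ).le
  filter_upwards [h] with x hx
  refine le_of_eq_of_le ?_ hx
  simp only [invQuad, zero_add]
  field_simp

end ProjBubble

/-! ### Radial integrals -/

section Radial

lemma integral_fun_norm_R4 (f : ℝ → ℝ) :
    ∫ x : R4, f ‖x‖ = areaS3 * ∫ t in Ioi (0 : ℝ), t ^ 3 * f t := by
  rw [integral_fun_norm_addHaar volume f, areaS3, Measure.toSphere_real_apply_univ]
  simp [mul_assoc]

lemma areaS3_pos : 0 < areaS3 := by
  rw [areaS3, Measure.toSphere_real_apply_univ]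
  have h : 0 < (volume : Measure R4).real (Metric.ball 0 1) :=
    ENNReal.toReal_pos (Metric.measure_ball_pos _ _ one_pos).ne' measure_ball_lt_top.ne
  have : 0 < Module.finrank ℝ R4 := by simp
  positivity

/-- In polar coordinates the density is `t³ · t⁻⁴ = 1 / t`: the source of the logarithm. -/
lemma integral_annulus_norm_pow_neg_four {a b : ℝ} (ha : 0 < a) (hab : a ≤ b) :
    ∫ x in {x : R4 | a < ‖x‖ ∧ ‖x‖ < b}, (‖x‖ ^ 4)⁻¹ = areaS3 * Real.log (b / a) := by
  have hm : MeasurableSet {x : R4 | a < ‖x‖ ∧ ‖x‖ < b} :=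
    (measurableSet_lt measurable_const measurable_norm).inter
      (measurableSet_lt measurable_norm measurable_const)
  rw [← integral_indicator hm]
  have e : ∀ x : R4, {x : R4 | a < ‖x‖ ∧ ‖x‖ < b}.indicator (fun x => (‖x‖ ^ 4)⁻¹) x
      = (Ioo a b).indicator (fun t => (t ^ 4)⁻¹) ‖x‖ := fun x => by
    simp [indicator_apply]
  simp only [e]
  rw [integral_fun_norm_R4]
  congr 1
  have e2 : ∀ t ∈ Ioi (0 : ℝ), t ^ 3 * (Ioo a b).indicator (fun t => (t ^ 4)⁻¹) t
      = (Ioo a b).indicator (fun t => t⁻¹) t := fun t ht => by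
    have : t ≠ 0 := ne_of_gt ht
    by_cases h : t ∈ Ioo a b
    · rw [indicator_of_mem h, indicator_of_mem h]; field_simp
    · rw [indicator_of_notMem h, indicator_of_notMem h, mul_zero]
  have hsub : Ioo a b ⊆ Ioi 0 := fun t ht => ha.trans ht.1
  rw [setIntegral_congr_fun measurableSet_Ioi e2, setIntegral_indicator measurableSet_Ioo,
    inter_eq_right.2 hsub, ← integral_Ioc_eq_integral_Ioo,
    ← intervalIntegral.integral_of_le hab, integral_inv_of_pos ha (ha.trans_le hab)]

/-- The radial density of `U_A² U_B²`. -/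
noncomputable def interactionDensity (A B t : ℝ) : ℝ :=
  t ^ 3 * ((A / (A ^ 2 + t ^ 2)) ^ 2 * (B / (B ^ 2 + t ^ 2)) ^ 2)

variable {A B : ℝ}

lemma continuous_interactionDensity (hA : 0 < A) (hB : 0 < B) :
    Continuous (interactionDensity A B) := by
  have h : ∀ {C : ℝ}, 0 < C → Continuous fun t : ℝ => C / (C ^ 2 + t ^ 2) := fun hC =>
    continuous_const.div (by fun_prop) fun t => by positivity
  exact (continuous_pow 3).mul (((h hA).pow 2).mul ((h hB).pow 2))

lemma interactionDensity_nonneg {t : ℝ} (ht : 0 ≤ t) : 0 ≤ interactionDensity A B t := by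
  unfold interactionDensity; positivity

lemma interactionDensity_le (hA : 0 < A) (hB : 0 < B) {t a b : ℝ} (ht : 0 ≤ t) (ha : 0 < a)
    (hb : 0 < b) (haA : a ≤ A ^ 2 + t ^ 2) (hbB : b ≤ B ^ 2 + t ^ 2) :
    interactionDensity A B t ≤ t ^ 3 * ((A / a) ^ 2 * (B / b) ^ 2) := by
  unfold interactionDensity
  gcongr

/-- Split at `A` and `B` and keep the dominant term of each denominator. The density is then at most
`t³ / (A B)²`, `(A/B)² / t` and `(A B)² t⁻⁵` respectively; the two outer pieces give `(A/B)² / 4`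
each and the middle one gives the logarithm. -/
lemma integral_interactionDensity_le (hA : 0 < A) (hAB : A ≤ B) :
    IntegrableOn (interactionDensity A B) (Ioi 0) ∧
      ∫ t in Ioi 0, interactionDensity A B t ≤ (A / B) ^ 2 * (Real.log (B / A) + 1 / 2) := by
  have hB : 0 < B := hA.trans_le hAB
  have hc := continuous_interactionDensity hA hB
  have i1 : IntegrableOn (interactionDensity A B) (Ioc 0 A) :=
    (hc.integrableOn_Icc).mono_set Ioc_subset_Icc_self
  have i2 : IntegrableOn (interactionDensity A B) (Ioc A B) :=
    (hc.integrableOn_Icc).mono_set Ioc_subset_Icc_self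
  have hle3 : ∀ t ∈ Ioi B, interactionDensity A B t ≤ (A * B) ^ 2 * t ^ (-5 : ℝ) := fun t ht => by
    have ht0 : 0 < t := hB.trans ht
    refine (interactionDensity_le hA hB ht0.le (a := t ^ 2) (b := t ^ 2) (by positivity)
      (by positivity) (by nlinarith [sq_nonneg A]) (by nlinarith [sq_nonneg B])).trans (le_of_eq ?_)
    rw [show (-5 : ℝ) = ((-5 : ℤ) : ℝ) by norm_num, Real.rpow_intCast, zpow_neg]
    norm_cast
    field_simp
  have i3' : IntegrableOn (fun t : ℝ => (A * B) ^ 2 * t ^ (-5 : ℝ)) (Ioi B) :=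
    (integrableOn_Ioi_rpow_of_lt (by norm_num) hB).const_mul _
  have i3 : IntegrableOn (interactionDensity A B) (Ioi B) := by
    refine Integrable.mono' i3' hc.aestronglyMeasurable ?_
    filter_upwards [ae_restrict_mem measurableSet_Ioi] with t ht
    rw [Real.norm_of_nonneg (interactionDensity_nonneg (hB.trans ht).le)]
    exact hle3 t ht
  have u1 : Ioi (0 : ℝ) = Ioc 0 A ∪ Ioi A := (Ioc_union_Ioi_eq_Ioi hA.le).symm
  have u2 : Ioi A = Ioc A B ∪ Ioi B := (Ioc_union_Ioi_eq_Ioi hAB).symm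
  have i4 : IntegrableOn (interactionDensity A B) (Ioi A) := by rw [u2]; exact i2.union i3
  refine ⟨by rw [u1]; exact i1.union i4, ?_⟩
  have b1 : ∫ t in Ioc 0 A, interactionDensity A B t ≤ (A / B) ^ 2 * (1 / 4) := by
    have : ∫ t in Ioc 0 A, interactionDensity A B t
        ≤ ∫ t in Ioc 0 A, t ^ 3 * ((A / A ^ 2) ^ 2 * (B / B ^ 2) ^ 2) := by
      refine setIntegral_mono_on i1 ?_ measurableSet_Ioc fun t ht => ?_
      · exact (Continuous.integrableOn_Icc (by fun_prop)).mono_set Ioc_subset_Icc_self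
      · exact interactionDensity_le hA hB ht.1.le (by positivity) (by positivity)
          (by nlinarith [sq_nonneg t]) (by nlinarith [sq_nonneg t])
    refine this.trans (le_of_eq ?_)
    rw [integral_mul_const, ← intervalIntegral.integral_of_le hA.le, integral_pow]
    field_simp
    ring
  have b2 : ∫ t in Ioc A B, interactionDensity A B t ≤ (A / B) ^ 2 * Real.log (B / A) := by
    have hcont : ContinuousOn (fun t : ℝ => (A / B) ^ 2 * t⁻¹) (Icc A B) :=
      continuousOn_const.mul (continuousOn_id.inv₀ fun t ht => (hA.trans_le ht.1).ne')
    have : ∫ t in Ioc A B, interactionDensity A B t ≤ ∫ t in Ioc A B, (A / B) ^ 2 * t⁻¹ := by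
      refine setIntegral_mono_on i2 (hcont.integrableOn_Icc.mono_set Ioc_subset_Icc_self)
        measurableSet_Ioc fun t ht => ?_
      have ht0 : 0 < t := hA.trans ht.1
      refine (interactionDensity_le hA hB ht0.le (a := t ^ 2) (b := B ^ 2) (by positivity)
        (by positivity) (by nlinarith [sq_nonneg A]) (by nlinarith [sq_nonneg t])).trans
        (le_of_eq ?_)
      field_simp
    refine this.trans (le_of_eq ?_)
    rw [integral_const_mul, ← intervalIntegral.integral_of_le hAB, integral_inv_of_pos hA hB]
  have b3 : ∫ t in Ioi B, interactionDensity A B t ≤ (A / B) ^ 2 * (1 / 4) := by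
    refine (setIntegral_mono_on i3 i3' measurableSet_Ioi hle3).trans (le_of_eq ?_)
    rw [integral_const_mul, integral_Ioi_rpow_of_lt (by norm_num) hB,
      show (-5 : ℝ) + 1 = ((-4 : ℤ) : ℝ) by norm_num, Real.rpow_intCast, zpow_neg]
    norm_cast
    field_simp
    norm_num
  rw [u1, setIntegral_union (Ioc_disjoint_Ioi le_rfl) measurableSet_Ioi i1 i4, u2,
    setIntegral_union (Ioc_disjoint_Ioi le_rfl) measurableSet_Ioi i2 i3]
  linarith

lemma bubble_sq_mul_bubble_sq (A B : ℝ) (x : R4) : bubble A x ^ 2 * bubble B x ^ 2 =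
    alpha4 ^ 4 * ((A / (A ^ 2 + ‖x‖ ^ 2)) ^ 2 * (B / (B ^ 2 + ‖x‖ ^ 2)) ^ 2) := by
  rw [bubble, bubble]; ring

lemma integrable_bubble_sq_mul_bubble_sq (hA : 0 < A) (hAB : A ≤ B) :
    Integrable fun x : R4 => bubble A x ^ 2 * bubble B x ^ 2 := by
  simp only [bubble_sq_mul_bubble_sq]
  refine Integrable.const_mul ?_ _
  refine (integrable_fun_norm_addHaar (volume : Measure R4)
    (f := fun t : ℝ => (A / (A ^ 2 + t ^ 2)) ^ 2 * (B / (B ^ 2 + t ^ 2)) ^ 2)).2 ?_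
  rw [finrank_euclideanSpace_fin]
  exact (integral_interactionDensity_le hA hAB).1

lemma integral_bubble_sq_mul_bubble_sq_le (hA : 0 < A) (hAB : A ≤ B) :
    ∫ x : R4, bubble A x ^ 2 * bubble B x ^ 2
      ≤ alpha4 ^ 4 * areaS3 * ((A / B) ^ 2 * (Real.log (B / A) + 1 / 2)) := by
  simp only [bubble_sq_mul_bubble_sq]
  rw [integral_const_mul, integral_fun_norm_R4
    (fun t : ℝ => (A / (A ^ 2 + t ^ 2)) ^ 2 * (B / (B ^ 2 + t ^ 2)) ^ 2), mul_assoc]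
  have := areaS3_pos
  have := alpha4_pos
  gcongr
  exact (integral_interactionDensity_le hA hAB).2

end Radial

/-! ### Two-sided bounds for the interaction integral -/

section Interaction
variable {Ω : Set R4} {ε A B : ℝ}

lemma integrable_projBubble_sq_mul (hΩo : IsOpen Ω) (hΩb : Bornology.IsBounded Ω) (hε : 0 < ε)
    (hA : 0 < A) (hAB : A ≤ B) :
    Integrable (fun x => projBubble Ω ε A x ^ 2 * projBubble Ω ε B x ^ 2)
      (volume.restrict (holedDomain Ω ε)) ∧
    ∀ᵐ x ∂(volume.restrict (holedDomain Ω ε)),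
      projBubble Ω ε A x ^ 2 * projBubble Ω ε B x ^ 2 ≤ bubble A x ^ 2 * bubble B x ^ 2 := by
  have hB : 0 < B := hA.trans_le hAB
  have hle : ∀ᵐ x ∂(volume.restrict (holedDomain Ω ε)),
      projBubble Ω ε A x ^ 2 * projBubble Ω ε B x ^ 2 ≤ bubble A x ^ 2 * bubble B x ^ 2 := by
    filter_upwards [projBubble_nonneg hΩo hΩb (ε := ε) hA, projBubble_nonneg hΩo hΩb (ε := ε) hB,
      projBubble_le_bubble hΩo hΩb hε hA, projBubble_le_bubble hΩo hΩb hε hB] with x h1 h2 h3 h4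
    gcongr
  obtain ⟨_, hWA, _⟩ := isDirichletSolution_projBubble (ε := ε) hΩb hA
  obtain ⟨_, hWB, _⟩ := isDirichletSolution_projBubble (ε := ε) hΩb hB
  refine ⟨Integrable.mono' (integrable_bubble_sq_mul_bubble_sq hA hAB).restrict
    ((hWA.1.1.pow 2).mul (hWB.1.1.pow 2)) ?_, hle⟩
  filter_upwards [hle] with x hx
  rwa [Real.norm_of_nonneg (by positivity)]

lemma integral_projBubble_sq_mul_le (hΩo : IsOpen Ω) (hΩb : Bornology.IsBounded Ω) (hε : 0 < ε)
    (hA : 0 < A) (hAB : A ≤ B) :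
    ∫ x in holedDomain Ω ε, projBubble Ω ε A x ^ 2 * projBubble Ω ε B x ^ 2
      ≤ alpha4 ^ 4 * areaS3 * ((A / B) ^ 2 * (Real.log (B / A) + 1 / 2)) := by
  obtain ⟨hi, hle⟩ := integrable_projBubble_sq_mul hΩo hΩb hε hA hAB
  have hI := integrable_bubble_sq_mul_bubble_sq hA hAB
  calc _ ≤ ∫ x in holedDomain Ω ε, bubble A x ^ 2 * bubble B x ^ 2 :=
        integral_mono_ae hi hI.restrict hle
    _ ≤ ∫ x, bubble A x ^ 2 * bubble B x ^ 2 :=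
        setIntegral_le_integral hI (ae_of_all _ fun x => by positivity)
    _ ≤ _ := integral_bubble_sq_mul_bubble_sq_le hA hAB

/-- On the annulus `M A < |x| < B / M` each projection is at least `1 - τ` times its model profile.
In `τ`, the term `1 / M²` pays for simplifying the denominators, `B² / r²` for the outer boundary
and `ε² / A²` for the hole. -/
lemma le_integral_projBubble_sq_mul (hΩo : IsOpen Ω) (hΩb : Bornology.IsBounded Ω) (hε : 0 < ε)
    {r M τ : ℝ} (hr : 0 < r) (hrΩ : Metric.ball 0 r ⊆ Ω) (hA : 0 < A) (hM : 1 ≤ M)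
    (hAB : M * A ≤ B / M) (hεA : ε < A) (hBr : B < r) (hτ1 : τ ≤ 1)
    (hτ : 1 / M ^ 2 + B ^ 2 / r ^ 2 + ε ^ 2 / A ^ 2 ≤ τ) :
    (1 - τ) ^ 4 * (alpha4 ^ 4 * areaS3 * ((A / B) ^ 2 * Real.log (B / M / (M * A))))
      ≤ ∫ x in holedDomain Ω ε, projBubble Ω ε A x ^ 2 * projBubble Ω ε B x ^ 2 := by
  have hα := alpha4_pos
  have hM0 : 0 < M := one_pos.trans_le hM
  have hMA : A ≤ M * A := le_mul_of_one_le_left hA.le hM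
  have hB : 0 < B := by
    have : 0 < B / M := (by positivity : 0 < M * A).trans_le hAB
    have := mul_pos this hM0
    rwa [div_mul_cancel₀ _ hM0.ne'] at this
  have hBM : B / M ≤ B := div_le_self hB.le hM
  have hle : A ≤ B := hMA.trans (hAB.trans hBM)
  obtain ⟨hi, -⟩ := integrable_projBubble_sq_mul hΩo hΩb hε hA hle
  set S : Set R4 := {x | M * A < ‖x‖ ∧ ‖x‖ < B / M} with hS
  have hSm : MeasurableSet S :=
    (measurableSet_lt measurable_const measurable_norm).inter
      (measurableSet_lt measurable_norm measurable_const)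
  have hSD : S ⊆ holedDomain Ω ε := fun x hx => by
    refine ⟨hrΩ ?_, ?_⟩
    · simpa using hx.2.trans_le hBM |>.trans hBr
    · simpa using hεA.trans_le hMA |>.trans hx.1
  have hpt : ∀ᵐ x ∂(volume.restrict S),
      (1 - τ) ^ 4 * (alpha4 ^ 4 * (A / B) ^ 2) * (‖x‖ ^ 4)⁻¹
        ≤ projBubble Ω ε A x ^ 2 * projBubble Ω ε B x ^ 2 := by
    have hres := Measure.restrict_mono hSD (le_refl (volume : Measure R4))
    filter_upwards [ae_mono hres (le_projBubble hΩo hΩb hε hA hr hrΩ),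
      ae_mono hres (le_projBubble hΩo hΩb hε hB hr hrΩ), ae_restrict_mem hSm] with x h1 h2 hx
    set t := ‖x‖ with ht
    have htA : M * A < t := hx.1
    have htB : t < B / M := hx.2
    have ht0 : 0 < t := (by positivity : 0 < M * A).trans htA
    have htB' : M * t < B := by rwa [lt_div_iff₀ hM0, mul_comm] at htB
    have q1 : A ^ 2 / t ^ 2 ≤ 1 / M ^ 2 := by
      rw [div_le_div_iff₀ (by positivity) (by positivity)]
      nlinarith [mul_pos hM0 hA]
    have q2 : t ^ 2 / B ^ 2 ≤ 1 / M ^ 2 := by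
      rw [div_le_div_iff₀ (by positivity) (by positivity)]
      nlinarith [mul_pos hM0 ht0]
    have q3 : t ^ 2 / r ^ 2 ≤ B ^ 2 / r ^ 2 := by
      gcongr
      exact (htB.trans_le hBM).le
    have q4 : ε ^ 2 / t ^ 2 ≤ ε ^ 2 / A ^ 2 := by
      gcongr
      exact hMA.trans htA.le
    have hinv : ∀ {s : ℝ}, 0 ≤ s → 1 - s ≤ 1 / (1 + s) := fun {s} hs => by
      rw [le_div_iff₀ (by positivity)]; nlinarith
    have p1 : (1 - τ) * (alpha4 * (A / t ^ 2)) ≤ projBubble Ω ε A x := by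
      refine le_trans ?_ h1
      -- Factor out the profile `α₄ A / t²` of the concentrated bubble; the three relative errors
      -- are then bounded by `q1`, `q3` and the hole term itself.
      have e : alpha4 * (A / (A ^ 2 + t ^ 2) - A / r ^ 2 - ε ^ 2 / (A * t ^ 2))
          = (1 / (1 + A ^ 2 / t ^ 2) - t ^ 2 / r ^ 2 - ε ^ 2 / A ^ 2) * (alpha4 * (A / t ^ 2)) := by
        field_simp
        ring
      rw [e]
      refine mul_le_mul_of_nonneg_right ?_ (by positivity)
      linarith [hinv (s := A ^ 2 / t ^ 2) (by positivity)]
    have p2 : (1 - τ) * (alpha4 / B) ≤ projBubble Ω ε B x := by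
      refine le_trans ?_ h2
      -- The flatter bubble is nearly the constant `α₄ / B`; here the relative errors are controlled
      -- by `q2`, `B² / r²` and `q4`.
      have e : alpha4 * (B / (B ^ 2 + t ^ 2) - B / r ^ 2 - ε ^ 2 / (B * t ^ 2))
          = (1 / (1 + t ^ 2 / B ^ 2) - B ^ 2 / r ^ 2 - ε ^ 2 / t ^ 2) * (alpha4 / B) := by
        field_simp
      rw [e]
      refine mul_le_mul_of_nonneg_right ?_ (by positivity)
      linarith [hinv (s := t ^ 2 / B ^ 2) (by positivity)]
    have hτ0 : 0 ≤ 1 - τ := by linarith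
    calc (1 - τ) ^ 4 * (alpha4 ^ 4 * (A / B) ^ 2) * (t ^ 4)⁻¹
        = ((1 - τ) * (alpha4 * (A / t ^ 2))) ^ 2 * ((1 - τ) * (alpha4 / B)) ^ 2 := by
          field_simp
      _ ≤ _ := by gcongr
  calc (1 - τ) ^ 4 * (alpha4 ^ 4 * areaS3 * ((A / B) ^ 2 * Real.log (B / M / (M * A))))
      = ∫ x in S, (1 - τ) ^ 4 * (alpha4 ^ 4 * (A / B) ^ 2) * (‖x‖ ^ 4)⁻¹ := by
        rw [integral_const_mul, integral_annulus_norm_pow_neg_four (by positivity) hAB]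
        ring
    _ ≤ ∫ x in S, projBubble Ω ε A x ^ 2 * projBubble Ω ε B x ^ 2 :=
        integral_mono_of_nonneg (ae_of_all _ fun x => by
          have : 0 ≤ 1 - τ := by linarith
          positivity) (IntegrableOn.mono_set hi hSD) hpt
    _ ≤ _ := setIntegral_mono_set hi (ae_of_all _ fun x => by positivity)
        (LE.le.eventuallyLE hSD)

end Interaction

/-! ### Separation of the concentration rates -/

section Rates

lemma tendsto_rpow_mul_log_rpow {a : ℝ} (ha : 0 < a) (b : ℝ) :
    Tendsto (fun ε : ℝ => ε ^ a * Real.log (1 / ε) ^ b) (𝓝[>] 0) (𝓝 0) := by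
  have h := (isLittleO_log_rpow_rpow_atTop b ha).tendsto_div_nhds_zero.comp tendsto_inv_nhdsGT_zero
  refine h.congr' ?_
  filter_upwards [self_mem_nhdsWithin] with ε hε
  have : 0 < ε := hε
  simp only [Function.comp_apply, one_div]
  rw [Real.inv_rpow this.le, div_inv_eq_mul, mul_comm]

lemma eventually_rpow_mul_log_rpow_le {a : ℝ} (ha : 0 < a) (b : ℝ) {s : ℝ} (hs : 0 < s) :
    ∀ᶠ ε : ℝ in 𝓝[>] 0, ε ^ a * Real.log (1 / ε) ^ b ≤ s :=
  (tendsto_rpow_mul_log_rpow ha b).eventually_le_const hs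

/-- Uniformly in the parameters, `δ_j → 0`, `ε / δ_i → 0` and, for `i > j`, `δ_i / δ_j → 0`. -/
lemma eventually_rate_le {k : ℕ} {η : ℝ} (hη : 0 < η) {i j : Fin k} (hij : j < i) {s : ℝ}
    (hs : 0 < s) : ∀ᶠ ε : ℝ in 𝓝[>] 0, ∀ d ∈ paramSet k η,
      0 < rate ε d i ∧ 0 < rate ε d j ∧ rate ε d j ≤ s ∧ ε ≤ s * rate ε d i ∧
        rate ε d i ≤ s * rate ε d j := by
  have hk : (0 : ℝ) < (k : ℝ) + 1 := by positivity
  set p : Fin k → ℝ := fun l => (((l : ℕ) : ℝ) + 1) / (k + 1) with hp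
  have hp0 : ∀ l, 0 < p l := fun l => by positivity
  have hp1 : ∀ l, p l < 1 := fun l => by
    rw [hp, div_lt_one hk]
    have : ((l : ℕ) : ℝ) < k := by exact_mod_cast l.2
    linarith
  have hpij : p j < p i := by
    have : ((j : ℕ) : ℝ) < (i : ℕ) := by exact_mod_cast hij
    simp only [hp]
    gcongr
  have hrate : ∀ ε d l, rate ε d l = d l * (ε ^ p l * Real.log (1 / ε) ^ (1 / 2 - p l)) :=
    fun ε d l => by rw [rate, mul_assoc]
  -- Uniformity in `d`: the thresholds `s η`, `s η` and `s η²` absorb the bounds `η < d_l < 1 / η`.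
  -- Every power of `ε` involved is positive since `0 < p j < p i < 1`, so the logarithmic factors
  -- do not matter.
  have e1 := eventually_rpow_mul_log_rpow_le (hp0 j) (1 / 2 - p j) (mul_pos hs hη)
  have e2 := eventually_rpow_mul_log_rpow_le (sub_pos.2 (hp1 i)) (-(1 / 2 - p i)) (mul_pos hs hη)
  have e3 := eventually_rpow_mul_log_rpow_le (sub_pos.2 hpij) ((1 / 2 - p i) - (1 / 2 - p j))
    (mul_pos hs (mul_pos hη hη))
  have e4 : ∀ᶠ ε : ℝ in 𝓝[>] 0, ε < 1 := nhdsWithin_le_nhds (eventually_lt_nhds one_pos)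
  filter_upwards [e1, e2, e3, e4, self_mem_nhdsWithin] with ε h1 h2 h3 h4 h5 d hd
  have hε : 0 < ε := h5
  have hL : 0 < Real.log (1 / ε) := Real.log_pos (by rw [lt_div_iff₀ hε]; linarith)
  have hd0 : ∀ l, 0 < d l := fun l => hη.trans (hd l).1
  have hdη : ∀ l, d l * η ≤ 1 := fun l => by
    have := (hd l).2
    rw [lt_div_iff₀ hη] at this
    exact this.le
  have hX0 : ∀ l, 0 < ε ^ p l * Real.log (1 / ε) ^ (1 / 2 - p l) := fun l => by positivity
  rw [hrate, hrate]
  refine ⟨mul_pos (hd0 i) (hX0 i), mul_pos (hd0 j) (hX0 j), ?_, ?_, ?_⟩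
  · calc _ ≤ d j * (s * η) := by gcongr; exact (hd0 j).le
      _ = s * (d j * η) := by ring
      _ ≤ s := mul_le_of_le_one_right hs.le (hdη j)
  · have e : ε ^ (1 - p i) * Real.log (1 / ε) ^ (-(1 / 2 - p i))
        * (ε ^ p i * Real.log (1 / ε) ^ (1 / 2 - p i)) = ε := by
      rw [mul_mul_mul_comm, ← Real.rpow_add hε, ← Real.rpow_add hL, sub_add_cancel,
        neg_add_cancel, Real.rpow_one, Real.rpow_zero, mul_one]
    calc ε = ε ^ (1 - p i) * Real.log (1 / ε) ^ (-(1 / 2 - p i))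
        * (ε ^ p i * Real.log (1 / ε) ^ (1 / 2 - p i)) := e.symm
      _ ≤ s * d i * (ε ^ p i * Real.log (1 / ε) ^ (1 / 2 - p i)) := by
        refine mul_le_mul_of_nonneg_right (h2.trans ?_) (hX0 i).le
        exact mul_le_mul_of_nonneg_left (hd i).1.le hs.le
      _ = _ := by ring
  · have e : ε ^ (p i - p j) * Real.log (1 / ε) ^ ((1 / 2 - p i) - (1 / 2 - p j))
        * (ε ^ p j * Real.log (1 / ε) ^ (1 / 2 - p j))
        = ε ^ p i * Real.log (1 / ε) ^ (1 / 2 - p i) := by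
      rw [mul_mul_mul_comm, ← Real.rpow_add hε, ← Real.rpow_add hL, sub_add_cancel,
        sub_add_cancel]
    rw [← e]
    calc _ ≤ d i * (s * (η * η) * (ε ^ p j * Real.log (1 / ε) ^ (1 / 2 - p j))) := by
          refine mul_le_mul_of_nonneg_left ?_ (hd0 i).le
          exact mul_le_mul_of_nonneg_right h3 (hX0 j).le
      _ = s * ((d i * η) * η * (ε ^ p j * Real.log (1 / ε) ^ (1 / 2 - p j))) := by ring
      _ ≤ s * (1 * d j * (ε ^ p j * Real.log (1 / ε) ^ (1 / 2 - p j))) := by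
          refine mul_le_mul_of_nonneg_left ?_ hs.le
          refine mul_le_mul_of_nonneg_right ?_ (hX0 j).le
          exact mul_le_mul (hdη i) (hd j).1.le hη.le zero_le_one
      _ = _ := by ring

end Rates

/-! ### Choice of constants and conclusion -/

/-- To be read with `q = (A/B)²`, `ℓ = log (B/A)`, `m = log M²` and `p = (1 - τ)⁴`. From below the
relative loss `4 K τ ℓ` and the fixed loss `K m` each cost at most `c ℓ / 2`; from above the excess
is `K / 2 ≤ c ℓ`. -/
lemma abs_sub_le_of_interaction_bounds {I K τ m ℓ q c p : ℝ} (hK : 0 ≤ K) (hτ : 0 ≤ τ)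
    (hm : 0 ≤ m) (hℓ : 0 ≤ ℓ) (hmℓ : 0 ≤ ℓ - m) (hq : 0 ≤ q) (hτK : 4 * K * τ ≤ c / 2)
    (hcℓ : K / 2 + 2 * K * m ≤ c * ℓ) (hp : 1 - 4 * τ ≤ p) (hlow : p * (K * (q * (ℓ - m))) ≤ I)
    (hup : I ≤ K * (q * (ℓ + 1 / 2))) : |I - K * (q * ℓ)| ≤ c * (q * ℓ) := by
  have hKm : 0 ≤ K * m := mul_nonneg hK hm
  rw [abs_le]
  constructor
  · have h1 : (1 - 4 * τ) * (K * (q * (ℓ - m))) ≤ p * (K * (q * (ℓ - m))) :=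
      mul_le_mul_of_nonneg_right hp (by positivity)
    have h2 : 0 ≤ K * m * τ := mul_nonneg hKm hτ
    have h3 : 0 ≤ (c / 2 - 4 * K * τ) * ℓ := mul_nonneg (by linarith) hℓ
    have h4 : K * ℓ - c * ℓ ≤ (1 - 4 * τ) * (K * (ℓ - m)) := by linarith
    have h5 := mul_le_mul_of_nonneg_left h4 hq
    linarith
  · have h1 : K / 2 ≤ c * ℓ := by linarith
    have h2 := mul_le_mul_of_nonneg_left h1 hq
    linarith

/-- Asymptotics of the interaction in terms of the smallness of `B`, `ε / A` and `A / B`. -/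
lemma exists_abs_integral_projBubble_sub_le {Ω : Set R4} (hΩo : IsOpen Ω)
    (hΩb : Bornology.IsBounded Ω) (h0 : (0 : R4) ∈ Ω) {c : ℝ} (hc : 0 < c) :
    ∃ s : ℝ, 0 < s ∧ ∀ ε A B : ℝ, 0 < ε → 0 < A → 0 < B → B ≤ s → ε ≤ s * A → A ≤ s * B →
      |(∫ x in holedDomain Ω ε, projBubble Ω ε A x ^ 2 * projBubble Ω ε B x ^ 2)
          - alpha4 ^ 4 * areaS3 * ((A / B) ^ 2 * Real.log (B / A))|
        ≤ c * |(A / B) ^ 2 * Real.log (B / A)| := by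
  obtain ⟨r, hr, hrΩ⟩ := Metric.isOpen_iff.1 hΩo 0 h0
  set K : ℝ := alpha4 ^ 4 * areaS3 with hK
  have hK0 : 0 < K := mul_pos (pow_pos alpha4_pos 4) areaS3_pos
  obtain ⟨τ, hτ0, hτ1, hτK⟩ : ∃ τ : ℝ, 0 < τ ∧ τ ≤ 1 ∧ 4 * K * τ ≤ c / 2 := by
    refine ⟨min 1 (c / (8 * K)), by positivity, min_le_left _ _, ?_⟩
    calc 4 * K * min 1 (c / (8 * K)) ≤ 4 * K * (c / (8 * K)) := by gcongr; exact min_le_right _ _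
      _ = c / 2 := by field_simp; norm_num
  -- Each of the three errors making up `τ` gets the share `τ / 3`; this `M` gives `1 / M² ≤ 1 / M =
  -- τ / 3`.
  set M : ℝ := 3 / τ with hM
  have hM1 : 1 ≤ M := by rw [hM, le_div_iff₀ hτ0]; linarith
  have hM0 : 0 < M := one_pos.trans_le hM1
  have hMτ : 1 / M ^ 2 ≤ τ / 3 := by
    have e : τ / 3 = 1 / M := by rw [hM]; field_simp
    rw [e]
    exact one_div_le_one_div_of_le hM0 (le_self_pow₀ hM1 two_ne_zero)
  set m : ℝ := Real.log (M * M) with hm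
  have hm0 : 0 ≤ m := Real.log_nonneg (by nlinarith)
  set N : ℝ := (K / 2 + 2 * K * m) / c with hN
  -- In order, the entries ensure `ε < A ≤ B`, `B < r`, the error shares of `ε² / A²` and `B² / r²`,
  -- a nondegenerate annulus `M A ≤ B / M`, and `log (B/A) ≥ N`. The last is chosen after `M`, so
  -- the logarithm outweighs `log M²`.
  set s : ℝ := min (min (min (1 / 2) (r / 2)) (min (τ / 3) (r * (τ / 3))))
    (min (1 / (M * M)) (Real.exp (-N))) with hs
  have hs0 : 0 < s := by positivity
  have s1 : s ≤ 1 / 2 := by simp [hs]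
  have s2 : s ≤ r / 2 := by simp [hs]
  have s3 : s ≤ τ / 3 := by simp [hs]
  have s4 : s ≤ r * (τ / 3) := by simp [hs]
  have s5 : s ≤ 1 / (M * M) := by simp [hs]
  have s6 : s ≤ Real.exp (-N) := by simp [hs]
  refine ⟨s, hs0, fun ε A B hε hA hB hBs hεA hAB => ?_⟩
  have hAB' : A ≤ B := hAB.trans (mul_le_of_le_one_left hB.le (by linarith))
  set ℓ : ℝ := Real.log (B / A) with hℓ
  have hℓN : N ≤ ℓ := by
    rw [hℓ, Real.le_log_iff_exp_le (by positivity), le_div_iff₀ hA]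
    calc Real.exp N * A ≤ Real.exp N * (Real.exp (-N) * B) := by
          gcongr
          exact hAB.trans (by gcongr)
      _ = B := by rw [← mul_assoc, ← Real.exp_add]; simp
  have hcℓ : K / 2 + 2 * K * m ≤ c * ℓ := by
    rw [hN, div_le_iff₀ hc] at hℓN
    linarith
  have hℓ0 : 0 ≤ ℓ := Real.log_nonneg (by rwa [le_div_iff₀ hA, one_mul])
  have hAB2 : 0 < (A / B) ^ 2 := by positivity
  have hup := integral_projBubble_sq_mul_le hΩo hΩb hε hA hAB'
  have hMAB : M * A ≤ B / M := by
    rw [le_div_iff₀ hM0]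
    have h := hAB.trans (mul_le_mul_of_nonneg_right s5 hB.le)
    rw [one_div_mul_eq_div, le_div_iff₀ (by positivity)] at h
    linarith
  have hτ3 : τ / 3 ≤ 1 := by linarith
  have hsq : ∀ {u : ℝ}, 0 ≤ u → u ≤ τ / 3 → u ^ 2 ≤ τ / 3 := fun h0 h1 =>
    (pow_le_of_le_one h0 (h1.trans hτ3) two_ne_zero).trans h1
  have a1 : B ^ 2 / r ^ 2 ≤ τ / 3 := by
    rw [← div_pow]
    exact hsq (by positivity) (by rw [div_le_iff₀ hr]; linarith)
  have a2 : ε ^ 2 / A ^ 2 ≤ τ / 3 := by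
    rw [← div_pow]
    exact hsq (by positivity) (((div_le_iff₀ hA).2 hεA).trans s3)
  have hεA' : ε < A :=
    hεA.trans_lt ((mul_le_mul_of_nonneg_right s1 hA.le).trans_lt (by linarith))
  have hlow := le_integral_projBubble_sq_mul hΩo hΩb hε (τ := τ) hr hrΩ hA hM1 hMAB hεA'
    (by linarith) hτ1 (by linarith)
  have hlog : Real.log (B / M / (M * A)) = ℓ - m := by
    rw [hℓ, hm, ← Real.log_div (by positivity) (by positivity)]
    congr 1
    field_simp
  rw [hlog, ← hK] at hlow
  rw [← hK] at hup
  -- Bernoulli's inequality makes the loss linear in `τ`.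
  have hbern : 1 - 4 * τ ≤ (1 - τ) ^ 4 := by
    have h1 := one_add_mul_le_pow (a := -τ) (by linarith) 4
    norm_num at h1
    rw [← sub_eq_add_neg] at h1
    linarith
  have hm4 : 0 ≤ ℓ - m := by
    rw [← hlog]
    refine Real.log_nonneg ?_
    rwa [le_div_iff₀ (by positivity), one_mul]
  rw [abs_of_nonneg (mul_nonneg hAB2.le hℓ0)]
  exact abs_sub_le_of_interaction_bounds hK0.le hτ0.le hm0 hℓ0 hm4 hAB2.le hτK hcℓ hbern hlow hup

theorem lemma4p4 (Ω : Set R4) (hΩo : IsOpen Ω) (hΩc : IsConnected Ω)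
    (hΩb : Bornology.IsBounded Ω) (hΩs : ∀ x, x ∈ Ω ↔ -x ∈ Ω) (h0 : (0 : R4) ∈ Ω)
    (k : ℕ) (η : ℝ) (hη : 0 < η) (i j : Fin k) (hij : j < i) :
    ∀ c : ℝ, 0 < c → ∃ ε₀ : ℝ, 0 < ε₀ ∧ ∀ ε : ℝ, 0 < ε → ε < ε₀ → ∀ d ∈ paramSet k η,
      |(∫ x in holedDomain Ω ε,
            projBubble Ω ε (rate ε d i) x ^ 2 * projBubble Ω ε (rate ε d j) x ^ 2)
          - alpha4 ^ 4 * areaS3 *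
            ((rate ε d i / rate ε d j) ^ 2 * Real.log (rate ε d j / rate ε d i))|
        ≤ c * |(rate ε d i / rate ε d j) ^ 2 * Real.log (rate ε d j / rate ε d i)| := by
  intro c hc
  obtain ⟨s, hs, h⟩ := exists_abs_integral_projBubble_sub_le hΩo hΩb h0 hc
  obtain ⟨ε₀, hε₀, hsub⟩ := mem_nhdsGT_iff_exists_Ioo_subset.1 (eventually_rate_le hη hij hs)
  refine ⟨ε₀, hε₀, fun ε hε hlt d hd => ?_⟩
  obtain ⟨hi, hj, hjs, hεi, hij'⟩ := hsub ⟨hε, hlt⟩ d hd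
  exact h ε _ _ hε hi hj hjs hεi hij'
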